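/- Let $\Omega$ be a finite set of equiangular lines through the origin in $\mathbf{R}^d$, with common angle whose cosine is $\kappa$, and let $\rho=\kappa^{-1}$. Writing $(\alpha,\beta)$ for the inner product of unit vectors representing lines $\alpha,\beta$, call a $3$-subset $\{\alpha,\beta,\gamma\}$ of $\Omega$ \emph{coherent} if $(\alpha,\beta)(\beta,\gamma)(\gamma,\alpha)<0$ (this does not depend on the choice of the unit vectors), let $\mathcal{C}$ be the set of coherent $3$-subsets, and call a subset of $\Omega$ \emph{incoherent} if none of its $3$-subsets is in $\mathcal{C}$. Let $\mathrm{Inc}(\Omega)$ be the maximum size of an incoherent subset of $\Omega$. Suppose that the two-graph $(\Omega,\mathcal{C})$ is regular, that is, every pair of distinct lines of $\Omega$ lies in the same number of coherent $3$-subsets, that $\mathrm{Inc}(\Omega)=d$, and let $\Gamma\subseteq\Omega$ be an incoherent set of $d$ lines. For $\gamma\in\Omega\setminus\Gamma$ there are $\alpha_1,\alpha_2\in\Gamma$ with $\{\gamma,\alpha_1,\alpha_2\}\in\mathcal{C}$; the sets $\Gamma_i(\gamma)=\{\delta\in\Gamma : \{\gamma,\alpha_i,\delta\}\in\mathcal{C}\}$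 $(i=1,2)$ partition $\Gamma$ and, up to their order, do not depend on the choice of $\alpha_1,\alpha_2$; they are labelled so that $|\Gamma_1(\gamma)|\le|\Gamma_2(\gamma)|$. Let $$\mathcal{B}_1=\{\Gamma_1(\gamma) : \gamma\in\Omega\setminus\Gamma\},$$ and suppose that $|\Gamma_1(\gamma)|<d/2$ for some $\gamma\in\Omega\setminus\Gamma$. Then either (i) $d=3$ and $\Omega$ is the image under a linear isometry of the six lines joining opposite vertices of a regular icosahedron centred at the origin; or (ii) $|\Omega|>2d$ and $(\Gamma,\mathcal{B}_1)$ is a quasi-symmetric $2$-$(d,k,\lambda;s_1,s_2)$ design, where $k$ is a root of the quadratic $$4x^2-4dx+(\rho-1)^2(d+\rho),$$ $\rho^2\neq d$, and $$\lambda=\frac{k(k-1)}{\rho^2-d},\qquad s_1=k-\frac{(\rho-1)^2}{4},\qquad s_2=k-\frac{\rho^2-1}{4};$$ moreover, in this case, $|\Omega|=d(d+1)/2$ if and only if $(\Gamma,\mathcal{B}_1)$ is a $3$-design. Here a $t$-$(v,k,\lambda)$ design is a pair $(\mathcal{P},\mathcal{B})$ consisting of a set $\mathcal{P}$ of $v$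 points and a set $\mathcal{B}$ of $k$-subsets (blocks) of $\mathcal{P}$ such that every $t$-subset of $\mathcal{P}$ is contained in exactly $\lambda\ge 0$ blocks; a $t$-design is a $t$-$(v,k,\lambda)$ design for some parameters $v,k,\lambda$. A $t$-$(v,k,\lambda;s_1,s_2)$ quasi-symmetric design is a $t$-$(v,k,\lambda)$ design in which the cardinalities of the intersections of two distinct blocks take exactly the two distinct values $s_1$ and $s_2$. -/

import Mathlib

open scoped LinearAlgebra.Projectivization

namespace EquiLines

noncomputable section

open scoped Classical

/-! ### Designs and two-graphs on a finite point set -/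

/-- `(X, B)` is a `t`-`(v, k, lam)` design: `X` has `v` points, `B` is a set of `k`-subsets of `X`, and
every `t`-subset of `X` lies in exactly `lam` members of `B` (the value `lam = 0` is allowed). -/
structure IsDesign {P : Type*} (t v k lam : ℕ) (X : Finset P) (B : Finset (Finset P)) : Prop where
  card_points : X.card = v
  block_subset : ∀ b ∈ B, b ⊆ X
  card_block : ∀ b ∈ B, b.card = k
  card_containing : ∀ T : Finset P, T ⊆ X → T.card = t → (B.filter (fun b => T ⊆ b)).card = lam

/-- `(X, B)` is a quasi-symmetric `t`-`(v, k, lam; s₁, s₂)` design: a design in which the sizes of the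
intersections of two distinct blocks take exactly the two different values `s₁` and `s₂`. -/
structure IsQuasiSymmetric {P : Type*} (t v k lam s₁ s₂ : ℕ) (X : Finset P)
    (B : Finset (Finset P)) : Prop where
  design : IsDesign t v k lam X B
  ne : s₁ ≠ s₂
  inter : ∀ b ∈ B, ∀ c ∈ B, b ≠ c → (b ∩ c).card = s₁ ∨ (b ∩ c).card = s₂
  attained₁ : ∃ b ∈ B, ∃ c ∈ B, b ≠ c ∧ (b ∩ c).card = s₁
  attained₂ : ∃ b ∈ B, ∃ c ∈ B, b ≠ c ∧ (b ∩ c).card = s₂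

/-- `(X, C)` is a two-graph: `C` is a set of `3`-subsets of `X` and every `4`-subset of `X` contains
an even number of members of `C`. -/
structure IsTwoGraph {P : Type*} (X : Finset P) (C : Finset (Finset P)) : Prop where
  triple_subset : ∀ T ∈ C, T ⊆ X
  card_triple : ∀ T ∈ C, T.card = 3
  even_four : ∀ Q : Finset P, Q ⊆ X → Q.card = 4 → Even (C.filter (fun T => T ⊆ Q)).card

/-- A two-graph is regular if it is a `2`-`(n, 3, a)` design for some `a`. -/
def IsRegularTwoGraph {P : Type*} (X : Finset P) (C : Finset (Finset P)) : Prop :=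
  IsTwoGraph X C ∧ ∃ a : ℕ, IsDesign 2 X.card 3 a X C

/-- `S` is incoherent: no `3`-subset of `S` is in `C` (no condition if `S` has at most two points). -/
def IsIncoherent {P : Type*} (C : Finset (Finset P)) (S : Finset P) : Prop :=
  ∀ T : Finset P, T ⊆ S → T.card = 3 → T ∉ C

/-! ### The two sets into which a point outside splits a maximal incoherent set -/

/-- The set of `δ ∈ Γ` for which `{γ, α, δ}` is a coherent triple. -/
def splitSet {P : Type*} (C : Finset (Finset P)) (Γ : Finset P) (γ α : P) : Finset P :=
  Γ.filter (fun δ => ({γ, α, δ} : Finset P) ∈ C)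

/-- `S₁, S₂` are the sets `Γ₁(γ), Γ₂(γ)`: for some `α₁, α₂ ∈ Γ` with `{γ, α₁, α₂}` coherent, `Sᵢ` is
the set of `δ ∈ Γ` with `{γ, αᵢ, δ}` coherent, and the labels are such that `|S₁| ≤ |S₂|`. -/
def IsSplit {P : Type*} (C : Finset (Finset P)) (Γ : Finset P) (γ : P) (S₁ S₂ : Finset P) : Prop :=
  ∃ α₁ ∈ Γ, ∃ α₂ ∈ Γ, ({γ, α₁, α₂} : Finset P) ∈ C ∧
    S₁ = splitSet C Γ γ α₁ ∧ S₂ = splitSet C Γ γ α₂ ∧ S₁.card ≤ S₂.card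

/-- The set `Γ₁(γ)` (a choice is made if the two sets have the same size). -/
def gammaOne {P : Type*} (C : Finset (Finset P)) (Γ : Finset P) (γ : P) : Finset P :=
  if h : ∃ S₁ S₂ : Finset P, IsSplit C Γ γ S₁ S₂ then h.choose else ∅

/-- `ℬ₁`, the set of all `Γ₁(γ)` with `γ ∈ Ω \ Γ`. -/
def blocksOne {P : Type*} (C : Finset (Finset P)) (Ω Γ : Finset P) : Finset (Finset P) :=
  (Ω \ Γ).image (gammaOne C Γ)

/-- If `Γ` is incoherent and stops being so when `γ` is added, then `Γ₁(γ)` is not a default value. -/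
theorem gammaOne_spec {P : Type*} {C : Finset (Finset P)} {Γ : Finset P} {γ : P}
    (hΓ : IsIncoherent C Γ) (hγ : ¬ IsIncoherent C (insert γ Γ)) :
    ∃ S₂ : Finset P, IsSplit C Γ γ (gammaOne C Γ γ) S₂ := by
  have h : ∃ S₁ S₂ : Finset P, IsSplit C Γ γ S₁ S₂ := by
    unfold IsIncoherent at hγ
    push Not at hγ
    obtain ⟨T, hT, h3, hC⟩ := hγ
    have hmem : γ ∈ T := by
      by_contra hn
      exact hΓ T ((Finset.subset_insert_iff_of_notMem hn).1 hT) h3 hC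
    have h2 : (T.erase γ).card = 2 := by rw [Finset.card_erase_of_mem hmem, h3]
    obtain ⟨α, β, -, hαβ⟩ := Finset.card_eq_two.1 h2
    have hTe : T = {γ, α, β} := by rw [← Finset.insert_erase hmem, hαβ]
    have hsub : T.erase γ ⊆ Γ := Finset.subset_insert_iff.1 hT
    have hα : α ∈ Γ := hsub (by simp [hαβ])
    have hβ : β ∈ Γ := hsub (by simp [hαβ])
    have hTe2 : T = {γ, β, α} := by rw [hTe, Finset.pair_comm]
    rcases le_total (splitSet C Γ γ α).card (splitSet C Γ γ β).card with hle | hle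
    · exact ⟨_, _, α, hα, β, hβ, hTe ▸ hC, rfl, rfl, hle⟩
    · exact ⟨_, _, β, hβ, α, hα, hTe2 ▸ hC, rfl, rfl, hle⟩
  have := h.choose_spec
  rwa [gammaOne, dif_pos h]

/-! ### Equiangular lines in `ℝᵈ` -/

/-- A line through the origin of `ℝᵈ`. -/
abbrev Line (d : ℕ) : Type := ℙ ℝ (EuclideanSpace ℝ (Fin d))

/-- A unit vector spanning the line `α`. -/
def unitVec {d : ℕ} (α : Line d) : EuclideanSpace ℝ (Fin d) := ‖α.rep‖⁻¹ • α.rep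

theorem norm_unitVec {d : ℕ} (α : Line d) : ‖unitVec α‖ = 1 := by
  have h : ‖α.rep‖ ≠ 0 := norm_ne_zero_iff.2 α.rep_nonzero
  rw [unitVec, norm_smul, norm_inv, norm_norm, inv_mul_cancel₀ h]

/-- The unit vector is unique up to sign; the notions below do not depend on the sign. -/
theorem eq_or_eq_neg_unitVec {d : ℕ} (α : Line d) (v : EuclideanSpace ℝ (Fin d))
    (hv : v ∈ α.submodule) (h1 : ‖v‖ = 1) : v = unitVec α ∨ v = -unitVec α := by
  have h : ‖α.rep‖ ≠ 0 := norm_ne_zero_iff.2 α.rep_nonzero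
  rw [Projectivization.submodule_eq, Submodule.mem_span_singleton] at hv
  obtain ⟨c, rfl⟩ := hv
  have hc : c • α.rep = (c * ‖α.rep‖) • unitVec α := by
    rw [unitVec, smul_smul, mul_assoc, mul_inv_cancel₀ h, mul_one]
  have habs : |c * ‖α.rep‖| = 1 := by
    rw [abs_mul, abs_norm, ← Real.norm_eq_abs, ← norm_smul, h1]
  rcases (abs_eq zero_le_one).1 habs with h2 | h2
  · left
    rw [hc, h2, one_smul]
  · right
    rw [hc, h2, neg_one_smul]

/-- The inner product `(α, β)` of unit vectors representing two lines. -/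
def lineInner {d : ℕ} (α β : Line d) : ℝ := inner ℝ (unitVec α) (unitVec β)

/-- `Ω` is a set of equiangular lines, `κ` being the cosine of the common angle. -/
def IsEquiangular {d : ℕ} (Ω : Finset (Line d)) (κ : ℝ) : Prop :=
  ∀ α ∈ Ω, ∀ β ∈ Ω, α ≠ β → |lineInner α β| = κ

/-- The coherent triples of `Ω`: the `3`-subsets `{α, β, γ}` with `(α, β)(β, γ)(γ, α) < 0`. -/
def coherentTriples {d : ℕ} (Ω : Finset (Line d)) : Finset (Finset (Line d)) :=
  (Ω.powersetCard 3).filter (fun T => ∃ α β γ : Line d, T = {α, β, γ} ∧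
    lineInner α β * lineInner β γ * lineInner γ α < 0)

/-- `Inc(Ω)`, the largest size of an incoherent subset of `Ω`. -/
def incNumber {d : ℕ} (Ω : Finset (Line d)) : ℕ :=
  (Ω.powerset.filter (fun S => IsIncoherent (coherentTriples Ω) S)).sup Finset.card

/-- The twelve vertices of a regular icosahedron centred at the origin: the cyclic permutations of
`(0, ±1, ±φ)`, where `φ` is the golden ratio. -/
def icosahedronVertices : Set (EuclideanSpace ℝ (Fin 3)) :=
  {v | ∃ s t : ℝ, (s = 1 ∨ s = -1) ∧ (t = 1 ∨ t = -1) ∧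
    (v = !₂[0, s, t * Real.goldenRatio] ∨ v = !₂[s, t * Real.goldenRatio, 0] ∨
      v = !₂[t * Real.goldenRatio, 0, s])}

/-- The six lines through opposite vertices of the icosahedron. -/
def icosahedralLines : Set (Line 3) :=
  {ℓ | ∃ v ∈ icosahedronVertices, ℓ.submodule = Submodule.span ℝ {v}}

/-- `Ω` is the image of the six icosahedral lines under a linear isometry. -/
def IsIcosahedral {d : ℕ} (Ω : Finset (Line d)) : Prop :=
  ∃ f : EuclideanSpace ℝ (Fin 3) ≃ₗᵢ[ℝ] EuclideanSpace ℝ (Fin d),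
    (Ω : Set (Line d)) =
      Projectivization.map f.toLinearEquiv.toLinearMap f.injective '' icosahedralLines

end

end EquiLines

/-! Incoherence of `Γ` allows unit vectors to be chosen so that those of `Γ` have pairwise inner
product `κ` and each line `γ` outside `Γ` has a negative inner product with at most half of `Γ`. Let
`N(γ)` be this negative part (`negSet`), and let `n = |Ω|`, `b = n - d`. The two parts of `Γ`
attached to `γ` are `N(γ)` and its complement, so `Γ₁(γ) = N(γ)` unless both have `d / 2` points
(`IsSplit.eq_negSet`).

The Gram matrix of `Γ` is `(1 - κ) I + κ J`, so its `d` vectors form a basis and every inner product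
can be computed from inner products with `Γ` (`IsSimplexBasis.inner_eq`). For `⟪w γ, w γ⟫ = 1` this
is the quadratic for `|N(γ)|`; its roots add up to `d`, so all blocks have the same size `k`, and `k
< d / 2` by the hypothesis on one line. For two lines it shows that `|N(γ) ∩ N(δ)|` depends only on
the sign of `⟪w γ, w δ⟫ = ±κ`, which gives the two intersection numbers.

Regularity says that the Gram matrix `M` of `Ω` satisfies `M² = p M + q`. As `n > d`, `M` is
singular, which forces `q = 0`, and the vectors form a tight frame with `p = n / d`
(`isTightSystem_of_regular`). Evaluated on vectors of `Γ`, the frame identity shows that points and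
pairs of points lie in constant numbers of blocks; evaluated on one line it gives `b (ρ² - d) = d (d
- 1)`.

If `b ≤ d`, inequalities leave only `d = 3`, `k = 1`, `ρ = √5`, and these determine the icosahedral
lines up to isometry. If `b > d`, both signs occur outside `Γ`: a sum of vectors with all inner
products `-κ` would have negative square norm, and inner products all `κ` would give an incoherent
set of more than `d` lines. Finally, being a `3`-design is equality in the Cauchy-Schwarz inequality
for the numbers of blocks through `3`-subsets. Two intersection numbers suffice to compute both
sides, and the defect vanishes exactly when `ρ² = d + 2`, that is, `n = d (d + 1) / 2`. -/

namespace EquiLines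

/-! ### Simplex bases and tight frames -/

section

open scoped Classical

open scoped RealInnerProductSpace

variable {ι E : Type*} [NormedAddCommGroup E] [InnerProductSpace ℝ E]

/-- The vectors `w i`, `i ∈ Γ`, are unit vectors with pairwise inner product `κ ∈ (0, 1)`, and their
number is the dimension of the space. -/
structure IsSimplexBasis (Γ : Finset ι) (w : ι → E) (κ : ℝ) : Prop where
  pos : 0 < κ
  lt_one : κ < 1
  inner_self : ∀ i ∈ Γ, ⟪w i, w i⟫ = 1
  inner_of_ne : ∀ i ∈ Γ, ∀ j ∈ Γ, i ≠ j → ⟪w i, w j⟫ = κ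
  card_eq : Γ.card = Module.finrank ℝ E

namespace IsSimplexBasis

variable {Γ : Finset ι} {w : ι → E} {κ : ℝ}

/-- The Gram matrix is `(1 - κ) I + κ J` with `J` the all-one matrix, so a row only sees its own
coefficient and the total of the coefficients. -/
theorem inner_sum_smul (h : IsSimplexBasis Γ w κ) (c : ι → ℝ) {j : ι} (hj : j ∈ Γ) :
    ⟪w j, ∑ i ∈ Γ, c i • w i⟫ = (1 - κ) * c j + κ * ∑ i ∈ Γ, c i := by
  have h1 : ∀ i ∈ Γ, ⟪w j, c i • w i⟫ = κ * c i + if i = j then (1 - κ) * c j else 0 := by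
    intro i hi
    rw [inner_smul_right]
    split_ifs with hij
    · subst hij
      rw [h.inner_self i hi]
      ring
    · rw [h.inner_of_ne j hj i hi (Ne.symm hij)]
      ring
  rw [inner_sum, Finset.sum_congr rfl h1, Finset.sum_add_distrib, ← Finset.mul_sum,
    Finset.sum_ite_eq' Γ j, if_pos hj]
  ring

theorem sum_inner_sum_smul (h : IsSimplexBasis Γ w κ) (c : ι → ℝ) :
    ∑ j ∈ Γ, ⟪w j, ∑ i ∈ Γ, c i • w i⟫ = (1 - κ + κ * Γ.card) * ∑ i ∈ Γ, c i := by
  rw [Finset.sum_congr rfl fun j hj => h.inner_sum_smul c hj, Finset.sum_add_distrib,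
    ← Finset.mul_sum, Finset.sum_const, nsmul_eq_mul]
  ring

/-- This number is the eigenvalue of the Gram matrix on the all-one vector; together with the
eigenvalue `1 - κ` it makes the matrix invertible. -/
theorem det_pos (h : IsSimplexBasis Γ w κ) : 0 < 1 - κ + κ * Γ.card := by
  have := mul_nonneg h.pos.le (Nat.cast_nonneg (α := ℝ) Γ.card)
  linarith [h.lt_one]

theorem linearIndependent (h : IsSimplexBasis Γ w κ) :
    LinearIndependent ℝ (fun i : Γ => w i) := by
  rw [Fintype.linearIndependent_iff]
  intro g hg
  set c : ι → ℝ := fun i => if hi : i ∈ Γ then g ⟨i, hi⟩ else 0 with hc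
  have h0 : ∑ i ∈ Γ, c i • w i = 0 := by
    rw [← Finset.sum_coe_sort, ← hg]
    exact Finset.sum_congr rfl fun i _ => by simp [hc]
  have h1 := h.sum_inner_sum_smul c
  simp only [h0, inner_zero_right, Finset.sum_const_zero] at h1
  have h2 : ∑ i ∈ Γ, c i = 0 := by
    rcases mul_eq_zero.1 h1.symm with h2 | h2
    · exact absurd h2 h.det_pos.ne'
    · exact h2
  intro i
  have h3 := h.inner_sum_smul c i.2
  rw [h0, inner_zero_right, h2, mul_zero, add_zero] at h3
  rcases mul_eq_zero.1 h3.symm with h4 | h4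
  · linarith [h.lt_one]
  · simpa [hc] using h4

variable [FiniteDimensional ℝ E]

theorem span_eq_top (h : IsSimplexBasis Γ w κ) :
    Submodule.span ℝ (Set.range fun i : Γ => w i) = ⊤ :=
  h.linearIndependent.span_eq_top_of_card_eq_finrank' (by simpa using h.card_eq)

theorem exists_sum_smul (h : IsSimplexBasis Γ w κ) (x : E) :
    ∃ c : ι → ℝ, x = ∑ i ∈ Γ, c i • w i := by
  have hx : x ∈ Submodule.span ℝ (Set.range fun i : Γ => w i) := by
    rw [h.span_eq_top]
    trivial
  obtain ⟨g, hg⟩ := (Submodule.mem_span_range_iff_exists_fun ℝ).1 hx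
  refine ⟨fun i => if hi : i ∈ Γ then g ⟨i, hi⟩ else 0, ?_⟩
  rw [← hg, ← Finset.sum_coe_sort Γ]
  exact Finset.sum_congr rfl fun i _ => by simp

theorem ext_inner (h : IsSimplexBasis Γ w κ) {x y : E} (hxy : ∀ i ∈ Γ, ⟪w i, x⟫ = ⟪w i, y⟫) :
    x = y := by
  obtain ⟨c, hc⟩ := h.exists_sum_smul (x - y)
  have h0 : ⟪x - y, x - y⟫ = 0 := by
    nth_rewrite 1 [hc]
    rw [sum_inner]
    refine Finset.sum_eq_zero fun i hi => ?_
    rw [real_inner_smul_left, inner_sub_right, hxy i hi, sub_self, mul_zero]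
  exact sub_eq_zero.1 (inner_self_eq_zero.1 h0)

/-- The inner product in terms of the inner products with the basis. -/
theorem inner_eq (h : IsSimplexBasis Γ w κ) (x y : E) :
    (1 - κ + κ * Γ.card) * ((1 - κ) * ⟪x, y⟫) =
      (1 - κ + κ * Γ.card) * (∑ i ∈ Γ, ⟪w i, x⟫ * ⟪w i, y⟫) -
        κ * (∑ i ∈ Γ, ⟪w i, x⟫) * ∑ i ∈ Γ, ⟪w i, y⟫ := by
  -- The inverse of `(1 - κ) I + κ J` is again a combination of `I` and `J`; the formula is this
  -- inverse with denominators cleared.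
  obtain ⟨c, rfl⟩ := h.exists_sum_smul x
  rw [h.sum_inner_sum_smul c, sum_inner]
  have h1 : ∑ i ∈ Γ, ⟪w i, ∑ i ∈ Γ, c i • w i⟫ * ⟪w i, y⟫ =
      (1 - κ) * (∑ i ∈ Γ, ⟪c i • w i, y⟫) + κ * (∑ i ∈ Γ, c i) * ∑ i ∈ Γ, ⟪w i, y⟫ := by
    rw [Finset.mul_sum, Finset.mul_sum, ← Finset.sum_add_distrib]
    refine Finset.sum_congr rfl fun i hi => ?_
    rw [h.inner_sum_smul c hi, real_inner_smul_left]
    ring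
  rw [h1]
  ring

end IsSimplexBasis

/-- If the Gram matrix `M` of a spanning family of more vectors than the dimension satisfies
`M² = p M + q`, then the family is a tight frame. -/
theorem tight_of_gram_sq [FiniteDimensional ℝ E] {Ω Γ : Finset ι} {w : ι → E} {κ p q : ℝ}
    (h : IsSimplexBasis Γ w κ) (hΓΩ : Γ ⊆ Ω) (hlt : Γ.card < Ω.card)
    (hM : ∀ α ∈ Ω, ∀ β ∈ Ω, ∑ γ ∈ Ω, ⟪w γ, w α⟫ * ⟪w γ, w β⟫ =
      p * ⟪w α, w β⟫ + if α = β then q else 0) :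
    q = 0 ∧ ∀ x y : E, ∑ γ ∈ Ω, ⟪w γ, x⟫ * ⟪w γ, y⟫ = p * ⟪x, y⟫ := by
  -- The vector of some `γ` in `Ω` outside `Γ` is a combination of those of `Γ`. Computed through
  -- this combination, the diagonal entry of `M²` at `γ` meets no term `q`; computed directly it
  -- contains one.
  have hq : q = 0 := by
    obtain ⟨γ, hγ, hγΓ⟩ := Finset.exists_mem_notMem_of_card_lt_card hlt
    obtain ⟨c, hc⟩ := h.exists_sum_smul (w γ)
    have h1 : ∑ β ∈ Γ, c β * (∑ δ ∈ Ω, ⟪w δ, w γ⟫ * ⟪w δ, w β⟫) =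
        ∑ δ ∈ Ω, ⟪w δ, w γ⟫ * ⟪w δ, w γ⟫ := by
      simp only [Finset.mul_sum]
      rw [Finset.sum_comm]
      refine Finset.sum_congr rfl fun δ _ => ?_
      conv_rhs =>
        rhs
        rw [hc, inner_sum]
      rw [Finset.mul_sum]
      refine Finset.sum_congr rfl fun β _ => ?_
      rw [inner_smul_right]
      ring
    have h2 : ∑ β ∈ Γ, c β * (∑ δ ∈ Ω, ⟪w δ, w γ⟫ * ⟪w δ, w β⟫) = p * ⟪w γ, w γ⟫ := by
      conv_rhs => rw [hc, inner_sum, ← hc, Finset.mul_sum]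
      refine Finset.sum_congr rfl fun β hβ => ?_
      rw [hM γ hγ β (hΓΩ hβ), if_neg (by rintro rfl; exact hγΓ hβ), inner_smul_right]
      ring
    rw [h2, hM γ hγ γ hγ, if_pos rfl] at h1
    linarith
  refine ⟨hq, fun x y => ?_⟩
  have h3 : ∀ i ∈ Γ, ∀ j ∈ Γ, ∑ γ ∈ Ω, ⟪w γ, w i⟫ * ⟪w γ, w j⟫ = p * ⟪w i, w j⟫ := by
    intro i hi j hj
    simp [hM i (hΓΩ hi) j (hΓΩ hj), hq]
  obtain ⟨c, rfl⟩ := h.exists_sum_smul x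
  obtain ⟨c', rfl⟩ := h.exists_sum_smul y
  calc ∑ γ ∈ Ω, ⟪w γ, ∑ i ∈ Γ, c i • w i⟫ * ⟪w γ, ∑ i ∈ Γ, c' i • w i⟫
      = ∑ γ ∈ Ω, ∑ i ∈ Γ, ∑ j ∈ Γ, c i * c' j * (⟪w γ, w i⟫ * ⟪w γ, w j⟫) := by
        refine Finset.sum_congr rfl fun γ _ => ?_
        rw [inner_sum, inner_sum, Finset.sum_mul_sum]
        refine Finset.sum_congr rfl fun i _ => Finset.sum_congr rfl fun j _ => ?_
        rw [inner_smul_right, inner_smul_right]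
        ring
    _ = ∑ i ∈ Γ, ∑ j ∈ Γ, c i * c' j * (p * ⟪w i, w j⟫) := by
        rw [Finset.sum_comm]
        refine Finset.sum_congr rfl fun i hi => ?_
        rw [Finset.sum_comm]
        refine Finset.sum_congr rfl fun j hj => ?_
        rw [← Finset.mul_sum, h3 i hi j hj]
    _ = _ := by
        rw [sum_inner, Finset.mul_sum]
        refine Finset.sum_congr rfl fun i _ => ?_
        rw [inner_sum, Finset.mul_sum]
        refine Finset.sum_congr rfl fun j _ => ?_
        rw [inner_smul_right, real_inner_smul_left]
        ring

/-- The constant of a tight frame of unit vectors. -/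
theorem card_eq_of_tight [FiniteDimensional ℝ E] {Ω : Finset ι} {w : ι → E} {p : ℝ}
    (hn : ∀ α ∈ Ω, ⟪w α, w α⟫ = 1)
    (ht : ∀ x y : E, ∑ γ ∈ Ω, ⟪w γ, x⟫ * ⟪w γ, y⟫ = p * ⟪x, y⟫) :
    (Ω.card : ℝ) = p * Module.finrank ℝ E := by
  -- The frame identity is summed over an orthonormal basis, which compares traces.
  set b := stdOrthonormalBasis ℝ E
  have h1 : ∑ i, ∑ γ ∈ Ω, ⟪w γ, b i⟫ * ⟪w γ, b i⟫ = p * Module.finrank ℝ E := by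
    simp [ht, mul_comm]
  rw [← h1, Finset.sum_comm, Finset.card_eq_sum_ones, Nat.cast_sum]
  refine Finset.sum_congr rfl fun γ hγ => ?_
  have h2 := b.sum_inner_mul_inner (w γ) (w γ)
  rw [hn γ hγ] at h2
  rw [Nat.cast_one, ← h2]
  exact Finset.sum_congr rfl fun i _ => by rw [real_inner_comm (w γ) (b i)]

end

/-! ### Negative sets in a tight system -/

section

open scoped Classical

open scoped RealInnerProductSpace

variable {ι E : Type*} [NormedAddCommGroup E] [InnerProductSpace ℝ E]

/-- The members of `Γ` whose vector has a negative inner product with that of `γ`. -/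
noncomputable def negSet (Γ : Finset ι) (w : ι → E) (γ : ι) : Finset ι :=
  Γ.filter fun i => ⟪w i, w γ⟫ < 0

theorem negSet_subset (Γ : Finset ι) (w : ι → E) (γ : ι) : negSet Γ w γ ⊆ Γ :=
  Finset.filter_subset _ _

/-- Unit vectors `w α`, `α ∈ Ω`, with pairwise inner products `±κ` that form a tight frame and contain a
basis with pairwise inner products `κ`. -/
structure IsTightSystem (Ω Γ : Finset ι) (w : ι → E) (κ : ℝ) : Prop where
  basis : IsSimplexBasis Γ w κ
  subset : Γ ⊆ Ω
  inner_self : ∀ α ∈ Ω, ⟪w α, w α⟫ = 1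
  abs_inner : ∀ α ∈ Ω, ∀ β ∈ Ω, α ≠ β → |⟪w α, w β⟫| = κ
  tight : ∀ x y : E, Γ.card * ∑ α ∈ Ω, ⟪w α, x⟫ * ⟪w α, y⟫ = Ω.card * ⟪x, y⟫

/-- Signs are encoded as `1 - 2 * indicator`, so that sums of signs become cardinalities. -/
theorem sum_one_sub_two_mul_ite {J : Type*} (s : Finset J) (p : J → Prop) [DecidablePred p] :
    ∑ i ∈ s, (1 - 2 * if p i then (1 : ℝ) else 0) = s.card - 2 * (s.filter p).card := by
  rw [Finset.sum_sub_distrib, ← Finset.mul_sum, Finset.sum_boole]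
  simp

theorem sum_one_sub_two_mul_ite_mul {J : Type*} (s : Finset J) (p q : J → Prop)
    [DecidablePred p] [DecidablePred q] :
    ∑ i ∈ s, (1 - 2 * if p i then (1 : ℝ) else 0) * (1 - 2 * if q i then (1 : ℝ) else 0) =
      s.card - 2 * (s.filter p).card - 2 * (s.filter q).card +
        4 * (s.filter fun i => p i ∧ q i).card := by
  have h : ∀ i ∈ s,
      (1 - 2 * if p i then (1 : ℝ) else 0) * (1 - 2 * if q i then (1 : ℝ) else 0) =
        1 - 2 * (if p i then (1 : ℝ) else 0) - 2 * (if q i then (1 : ℝ) else 0) +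
          4 * if p i ∧ q i then (1 : ℝ) else 0 := by
    intro i _
    by_cases hp : p i <;> by_cases hq : q i <;>
      simp only [hp, hq, if_true, if_false, and_self, and_true, and_false] <;> norm_num
  rw [Finset.sum_congr rfl h, Finset.sum_add_distrib, Finset.sum_sub_distrib,
    Finset.sum_sub_distrib, ← Finset.mul_sum, ← Finset.mul_sum, ← Finset.mul_sum,
    Finset.sum_boole, Finset.sum_boole, Finset.sum_boole]
  simp

theorem filter_mem_negSet (Γ : Finset ι) (w : ι → E) (γ : ι) :
    (Γ.filter fun i => i ∈ negSet Γ w γ) = negSet Γ w γ :=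
  (Finset.filter_mem_eq_inter).trans (Finset.inter_eq_right.2 (negSet_subset Γ w γ))

theorem filter_mem_negSet_and (Γ : Finset ι) (w : ι → E) (γ δ : ι) :
    (Γ.filter fun i => i ∈ negSet Γ w γ ∧ i ∈ negSet Γ w δ) = negSet Γ w γ ∩ negSet Γ w δ := by
  ext i
  simp only [Finset.mem_filter, Finset.mem_inter]
  exact ⟨fun h => h.2, fun h => ⟨negSet_subset Γ w γ h.1, h⟩⟩

namespace IsTightSystem

variable {Ω Γ : Finset ι} {w : ι → E} {κ : ℝ}

theorem inner_eq_ite (h : IsTightSystem Ω Γ w κ) {γ i : ι} (hγ : γ ∈ Ω \ Γ) (hi : i ∈ Γ) :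
    ⟪w i, w γ⟫ = κ * (1 - 2 * if i ∈ negSet Γ w γ then (1 : ℝ) else 0) := by
  obtain ⟨hγΩ, hγΓ⟩ := Finset.mem_sdiff.1 hγ
  have h1 := h.abs_inner i (h.subset hi) γ hγΩ (by rintro rfl; exact hγΓ hi)
  simp only [negSet, Finset.mem_filter, hi, true_and]
  split_ifs with h2
  · rw [abs_of_neg h2] at h1
    linarith
  · rw [abs_of_nonneg (not_lt.1 h2)] at h1
    linarith

theorem sum_inner_eq (h : IsTightSystem Ω Γ w κ) {γ : ι} (hγ : γ ∈ Ω \ Γ) :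
    ∑ i ∈ Γ, ⟪w i, w γ⟫ = κ * (Γ.card - 2 * (negSet Γ w γ).card) := by
  rw [Finset.sum_congr rfl fun i hi => h.inner_eq_ite hγ hi, ← Finset.mul_sum,
    sum_one_sub_two_mul_ite, filter_mem_negSet]

theorem sum_inner_mul_inner (h : IsTightSystem Ω Γ w κ) {γ δ : ι} (hγ : γ ∈ Ω \ Γ)
    (hδ : δ ∈ Ω \ Γ) :
    ∑ i ∈ Γ, ⟪w i, w γ⟫ * ⟪w i, w δ⟫ = κ ^ 2 * (Γ.card - 2 * (negSet Γ w γ).card -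
      2 * (negSet Γ w δ).card + 4 * (negSet Γ w γ ∩ negSet Γ w δ).card) := by
  have h1 : ∀ i ∈ Γ, ⟪w i, w γ⟫ * ⟪w i, w δ⟫ =
      κ ^ 2 * ((1 - 2 * if i ∈ negSet Γ w γ then (1 : ℝ) else 0) *
        (1 - 2 * if i ∈ negSet Γ w δ then (1 : ℝ) else 0)) := by
    intro i hi
    rw [h.inner_eq_ite hγ hi, h.inner_eq_ite hδ hi]
    ring
  rw [Finset.sum_congr rfl h1, ← Finset.mul_sum, sum_one_sub_two_mul_ite_mul, filter_mem_negSet,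
    filter_mem_negSet, filter_mem_negSet_and]

theorem one_lt_inv (h : IsTightSystem Ω Γ w κ) : 1 < κ⁻¹ :=
  (one_lt_inv₀ h.basis.pos).2 h.basis.lt_one

/-- The number of lines in terms of the angle and the dimension. -/
theorem card_mul (h : IsTightSystem Ω Γ w κ) {α : ι} (hα : α ∈ Ω) :
    (Ω.card : ℝ) * (κ⁻¹ ^ 2 - Γ.card) = Γ.card * (κ⁻¹ ^ 2 - 1) := by
  -- At `x = y = w α` the frame sum is `1 + (n - 1) κ²`.
  have h1 := h.tight (w α) (w α)
  have h2 : ∑ β ∈ Ω.erase α, ⟪w β, w α⟫ * ⟪w β, w α⟫ = (Ω.card - 1) * κ ^ 2 := by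
    rw [Finset.sum_congr rfl (g := fun _ => κ ^ 2), Finset.sum_const, nsmul_eq_mul,
      Finset.card_erase_of_mem hα, Nat.cast_sub (Finset.card_pos.2 ⟨α, hα⟩), Nat.cast_one]
    intro β hβ
    rw [← sq, ← sq_abs, h.abs_inner β (Finset.mem_of_mem_erase hβ) α hα (Finset.ne_of_mem_erase hβ)]
  rw [← Finset.add_sum_erase Ω _ hα, h2, h.inner_self α hα] at h1
  have hκ := h.basis.pos.ne'
  field_simp
  linear_combination -h1

theorem sum_sdiff (h : IsTightSystem Ω Γ w κ) (x y : E) :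
    Γ.card * (∑ γ ∈ Ω \ Γ, ⟪w γ, x⟫ * ⟪w γ, y⟫) =
      Ω.card * ⟪x, y⟫ - Γ.card * ∑ i ∈ Γ, ⟪w i, x⟫ * ⟪w i, y⟫ := by
  rw [← h.tight, ← Finset.sum_sdiff h.subset]
  ring

theorem inner_sum_basis (h : IsTightSystem Ω Γ w κ) {j : ι} (hj : j ∈ Γ) :
    ⟪w j, ∑ i ∈ Γ, w i⟫ = 1 - κ + κ * Γ.card := by
  have h1 := h.basis.inner_sum_smul (fun _ => 1) hj
  simp only [one_smul, Finset.sum_const, nsmul_eq_mul, mul_one] at h1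
  exact h1

/-- Every point of `Γ` lies in the same number of sets `negSet Γ w γ`. -/
theorem card_filter_mem (h : IsTightSystem Ω Γ w κ) {k : ℕ}
    (hk : ∀ γ ∈ Ω \ Γ, (negSet Γ w γ).card = k) (hkd : 2 * k ≠ Γ.card) {i j : ι} (hi : i ∈ Γ)
    (hj : j ∈ Γ) :
    ((Ω \ Γ).filter fun γ => i ∈ negSet Γ w γ).card =
      ((Ω \ Γ).filter fun γ => j ∈ negSet Γ w γ).card := by
  have hd : (Γ.card : ℝ) ≠ 0 := Nat.cast_ne_zero.2 (Finset.card_pos.2 ⟨i, hi⟩).ne'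
  have hκ := h.basis.pos.ne'
  have hσ : (Γ.card : ℝ) - 2 * k ≠ 0 := by
    rw [sub_ne_zero]
    exact_mod_cast hkd.symm
  -- The frame identity is applied to the sum of the basis and `w j`. As `|N(γ)| = k` throughout,
  -- the left side is `κ² (d - 2k)` times a sum of signs at `j`, while the right side does not
  -- depend on `j`; `2k ≠ d` is what permits cancelling.
  have key : ∀ j ∈ Γ, Γ.card * (κ ^ 2 * (Γ.card - 2 * k) * ((Ω \ Γ).card -
      2 * ((Ω \ Γ).filter fun γ => j ∈ negSet Γ w γ).card)) =
      Ω.card * (1 - κ + κ * Γ.card) - Γ.card * (1 - κ + κ * Γ.card) ^ 2 := by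
    intro j hj
    have h1 := h.sum_sdiff (∑ i ∈ Γ, w i) (w j)
    have h2 : ∀ γ ∈ Ω \ Γ, ⟪w γ, ∑ i ∈ Γ, w i⟫ * ⟪w γ, w j⟫ = κ ^ 2 * (Γ.card - 2 * k) *
        (1 - 2 * if j ∈ negSet Γ w γ then (1 : ℝ) else 0) := by
      intro γ hγ
      rw [real_inner_comm (w j) (w γ), h.inner_eq_ite hγ hj, real_inner_comm, sum_inner,
        h.sum_inner_eq hγ, hk γ hγ]
      ring
    have h3 : ∑ l ∈ Γ, ⟪w l, ∑ i ∈ Γ, w i⟫ * ⟪w l, w j⟫ = (1 - κ + κ * Γ.card) ^ 2 := by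
      rw [Finset.sum_congr rfl fun l hl => by rw [h.inner_sum_basis hl], ← Finset.mul_sum,
        Finset.sum_congr rfl fun l _ => real_inner_comm (w j) (w l), ← inner_sum,
        h.inner_sum_basis hj, sq]
    rw [Finset.sum_congr rfl h2, ← Finset.mul_sum, sum_one_sub_two_mul_ite, h3, real_inner_comm,
      h.inner_sum_basis hj] at h1
    exact h1
  have h4 := (key i hi).trans (key j hj).symm
  have h5 := mul_left_cancel₀ (mul_ne_zero (pow_ne_zero 2 hκ) hσ) (mul_left_cancel₀ hd h4)
  have h6 : (((Ω \ Γ).filter fun γ => i ∈ negSet Γ w γ).card : ℝ) =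
      ((Ω \ Γ).filter fun γ => j ∈ negSet Γ w γ).card := by linarith
  exact_mod_cast h6

/-- Every pair of points of `Γ` lies in the same number of sets `negSet Γ w γ`. -/
theorem exists_card_filter_mem_and (h : IsTightSystem Ω Γ w κ) {k : ℕ}
    (hk : ∀ γ ∈ Ω \ Γ, (negSet Γ w γ).card = k) (hkd : 2 * k ≠ Γ.card) :
    ∃ lam : ℕ, ∀ i ∈ Γ, ∀ j ∈ Γ, i ≠ j →
      ((Ω \ Γ).filter fun γ => i ∈ negSet Γ w γ ∧ j ∈ negSet Γ w γ).card = lam := by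
  have hκ := h.basis.pos.ne'
  -- The same with `w i` and `w j`: the right side is the same for all pairs, and the counts at
  -- single points are already constant.
  have key : ∀ i ∈ Γ, ∀ j ∈ Γ, i ≠ j → Γ.card * (κ ^ 2 * ((Ω \ Γ).card -
      2 * ((Ω \ Γ).filter fun γ => i ∈ negSet Γ w γ).card -
      2 * ((Ω \ Γ).filter fun γ => j ∈ negSet Γ w γ).card +
      4 * ((Ω \ Γ).filter fun γ => i ∈ negSet Γ w γ ∧ j ∈ negSet Γ w γ).card)) =
      Ω.card * κ - Γ.card * ((1 - κ) * κ + κ * (1 - κ + κ * Γ.card)) := by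
    intro i hi j hj hij
    have h1 := h.sum_sdiff (w i) (w j)
    have h2 : ∀ γ ∈ Ω \ Γ, ⟪w γ, w i⟫ * ⟪w γ, w j⟫ = κ ^ 2 *
        ((1 - 2 * if i ∈ negSet Γ w γ then (1 : ℝ) else 0) *
          (1 - 2 * if j ∈ negSet Γ w γ then (1 : ℝ) else 0)) := by
      intro γ hγ
      rw [real_inner_comm (w j) (w γ), h.inner_eq_ite hγ hj, real_inner_comm,
        h.inner_eq_ite hγ hi]
      ring
    have h3 : ∑ l ∈ Γ, ⟪w l, w i⟫ * ⟪w l, w j⟫ =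
        (1 - κ) * κ + κ * (1 - κ + κ * Γ.card) := by
      have h4 := h.basis.inner_sum_smul (fun l => ⟪w l, w i⟫) hj
      have h5 : ∑ l ∈ Γ, ⟪w l, w i⟫ = 1 - κ + κ * Γ.card := by
        rw [← h.inner_sum_basis hi, real_inner_comm, sum_inner]
      rw [inner_sum, h5, h.basis.inner_of_ne j hj i hi hij.symm] at h4
      rw [← h4]
      refine Finset.sum_congr rfl fun l _ => ?_
      rw [inner_smul_right, real_inner_comm (w j) (w l)]
    rw [Finset.sum_congr rfl h2, ← Finset.mul_sum, sum_one_sub_two_mul_ite_mul, h3,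
      h.basis.inner_of_ne i hi j hj hij] at h1
    exact h1
  by_cases hex : ∃ a ∈ Γ, ∃ b ∈ Γ, a ≠ b
  · obtain ⟨a, ha, b, hb, hab⟩ := hex
    refine ⟨((Ω \ Γ).filter fun γ => a ∈ negSet Γ w γ ∧ b ∈ negSet Γ w γ).card, ?_⟩
    intro i hi j hj hij
    have hd : (Γ.card : ℝ) ≠ 0 := Nat.cast_ne_zero.2 (Finset.card_pos.2 ⟨i, hi⟩).ne'
    have h4 := mul_left_cancel₀ (pow_ne_zero 2 hκ) (mul_left_cancel₀ hd
      ((key i hi j hj hij).trans (key a ha b hb hab).symm))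
    rw [h.card_filter_mem hk hkd hi ha, h.card_filter_mem hk hkd hj hb] at h4
    have h6 : (((Ω \ Γ).filter fun γ => i ∈ negSet Γ w γ ∧ j ∈ negSet Γ w γ).card : ℝ) =
      ((Ω \ Γ).filter fun γ => a ∈ negSet Γ w γ ∧ b ∈ negSet Γ w γ).card := by linarith
    exact_mod_cast h6
  · exact ⟨0, fun i hi j hj hij => absurd ⟨i, hi, j, hj, hij⟩ hex⟩

variable [FiniteDimensional ℝ E]

/-- The quadratic satisfied by the size of the sets `negSet Γ w γ`. -/
theorem quadratic (h : IsTightSystem Ω Γ w κ) {γ : ι} (hγ : γ ∈ Ω \ Γ) :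
    4 * ((negSet Γ w γ).card : ℝ) ^ 2 - 4 * Γ.card * (negSet Γ w γ).card +
      (κ⁻¹ - 1) ^ 2 * (Γ.card + κ⁻¹) = 0 := by
  -- All terms are known: `⟪w γ, w γ⟫ = 1`, the squares sum to `κ² d`, and the inner products sum to
  -- `κ (d - 2 |N(γ)|)`.
  have h1 := h.basis.inner_eq (w γ) (w γ)
  rw [h.sum_inner_mul_inner hγ hγ, h.sum_inner_eq hγ, h.inner_self γ (Finset.mem_sdiff.1 hγ).1,
    Finset.inter_self] at h1
  have hκ := h.basis.pos.ne'
  field_simp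
  linear_combination h1

/-- The inner product of `w γ` and `w δ` in terms of the intersection of `negSet Γ w γ` and
`negSet Γ w δ`. -/
theorem inner_eq_card_inter (h : IsTightSystem Ω Γ w κ) {γ δ : ι} (hγ : γ ∈ Ω \ Γ)
    (hδ : δ ∈ Ω \ Γ) (hk : (negSet Γ w γ).card = (negSet Γ w δ).card) :
    (κ⁻¹ - 1) * κ⁻¹ * (1 - ⟪w γ, w δ⟫) =
      4 * ((negSet Γ w γ).card - (negSet Γ w γ ∩ negSet Γ w δ).card) := by
  -- Since the two sets have the same size, subtracting this formula from the one for `⟪w γ, w γ⟫`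
  -- cancels all but the intersection term.
  have h1 := h.basis.inner_eq (w γ) (w δ)
  have h2 := h.basis.inner_eq (w γ) (w γ)
  rw [h.sum_inner_mul_inner hγ hδ, h.sum_inner_eq hγ, h.sum_inner_eq hδ, ← hk] at h1
  rw [h.sum_inner_mul_inner hγ hγ, h.sum_inner_eq hγ, h.inner_self γ (Finset.mem_sdiff.1 hγ).1,
    Finset.inter_self] at h2
  have hκ := h.basis.pos.ne'
  field_simp
  refine mul_left_cancel₀ h.basis.det_pos.ne' ?_
  linear_combination h2 - h1

/-- The set fixes all inner products with a basis, hence the vector, and distinct lines cannot share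
a vector because `κ < 1`. -/
theorem injOn_negSet (h : IsTightSystem Ω Γ w κ) :
    Set.InjOn (negSet Γ w) (Ω \ Γ : Finset ι) := by
  intro γ hγ δ hδ hN
  have hw : w γ = w δ := h.basis.ext_inner fun i hi => by
    rw [h.inner_eq_ite hγ hi, h.inner_eq_ite hδ hi, hN]
  by_contra hne
  have hγΩ := (Finset.mem_sdiff.1 hγ).1
  have h1 := h.abs_inner γ hγΩ δ (Finset.mem_sdiff.1 hδ).1 hne
  rw [← hw, h.inner_self γ hγΩ, abs_one] at h1
  exact h.basis.lt_one.ne h1.symm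

end IsTightSystem

end

/-! ### Double counting and the criterion for a 3-design -/

section

open scoped Classical

variable {P : Type*}

theorem six_mul_choose_three (n : ℕ) : 6 * (n.choose 3 : ℝ) = n * (n - 1) * (n - 2) := by
  induction n with
  | zero => simp
  | succ m ih =>
    rw [Nat.choose_succ_succ', Nat.cast_add, mul_add, ih, Nat.cast_choose_two]
    push_cast
    ring

theorem two_mul_choose_two (n : ℕ) : 2 * (n.choose 2 : ℝ) = n * (n - 1) := by
  rw [Nat.cast_choose_two]
  ring

/-- Double counting of the pairs `T ⊆ b` with `b` a block and `T` a `t`-subset. -/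
theorem sum_card_filter_subset {X : Finset P} {B : Finset (Finset P)} (hB : ∀ b ∈ B, b ⊆ X)
    (t : ℕ) :
    ∑ T ∈ X.powersetCard t, ((B.filter fun b => T ⊆ b).card : ℝ) =
      ∑ b ∈ B, (b.card.choose t : ℝ) := by
  simp only [Finset.card_filter, Nat.cast_sum]
  rw [Finset.sum_comm]
  refine Finset.sum_congr rfl fun b hb => ?_
  rw [← Nat.cast_sum, ← Finset.card_filter, ← Finset.card_powersetCard t b]
  congr 2
  ext T
  simp only [Finset.mem_filter, Finset.mem_powersetCard]
  exact ⟨fun h => ⟨h.2, h.1.2⟩, fun h => ⟨⟨h.1.trans (hB b hb), h.2⟩, h.1⟩⟩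

/-- Double counting of the triples `T ⊆ b ∩ c` with `b`, `c` blocks and `T` a `t`-subset. -/
theorem sum_card_filter_subset_sq {X : Finset P} {B : Finset (Finset P)} (hB : ∀ b ∈ B, b ⊆ X)
    (t : ℕ) :
    ∑ T ∈ X.powersetCard t, ((B.filter fun b => T ⊆ b).card : ℝ) ^ 2 =
      ∑ b ∈ B, ∑ c ∈ B, ((b ∩ c).card.choose t : ℝ) := by
  have h1 : ∀ T ∈ X.powersetCard t, ((B.filter fun b => T ⊆ b).card : ℝ) ^ 2 =
      ∑ b ∈ B, ∑ c ∈ B, if T ⊆ b ∩ c then (1 : ℝ) else 0 := by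
    intro T _
    rw [sq, Finset.card_filter, Nat.cast_sum, Finset.sum_mul_sum]
    refine Finset.sum_congr rfl fun b _ => Finset.sum_congr rfl fun c _ => ?_
    by_cases hb : T ⊆ b <;> by_cases hc : T ⊆ c <;> simp [hb, hc, Finset.subset_inter_iff]
  rw [Finset.sum_congr rfl h1, Finset.sum_comm]
  refine Finset.sum_congr rfl fun b hb => ?_
  rw [Finset.sum_comm]
  refine Finset.sum_congr rfl fun c hc => ?_
  rw [Finset.sum_boole, ← Finset.card_powersetCard t (b ∩ c)]
  congr 2
  ext T
  simp only [Finset.mem_filter, Finset.mem_powersetCard]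
  exact ⟨fun h => ⟨h.2, h.1.2⟩,
    fun h => ⟨⟨(h.1.trans Finset.inter_subset_left).trans (hB b hb), h.2⟩, h.1⟩⟩

/-- Equality in the Cauchy-Schwarz inequality for the sum of the values of a function. -/
theorem forall_eq_iff_card_mul_sum_sq {J : Type*} (s : Finset J) (hs : s.Nonempty) (f : J → ℝ) :
    (∀ i ∈ s, ∀ j ∈ s, f i = f j) ↔ s.card * ∑ i ∈ s, f i ^ 2 = (∑ i ∈ s, f i) ^ 2 := by
  have hc : (0 : ℝ) < s.card := Nat.cast_pos.2 hs.card_pos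
  have h1 : ∑ i ∈ s, (s.card * f i - ∑ j ∈ s, f j) ^ 2 =
      s.card * (s.card * (∑ i ∈ s, f i ^ 2) - (∑ i ∈ s, f i) ^ 2) := by
    have h2 : ∀ i ∈ s, (s.card * f i - ∑ j ∈ s, f j) ^ 2 = (s.card : ℝ) ^ 2 * f i ^ 2 -
        2 * s.card * (∑ j ∈ s, f j) * f i + (∑ j ∈ s, f j) ^ 2 := fun i _ => by ring
    rw [Finset.sum_congr rfl h2, Finset.sum_add_distrib, Finset.sum_sub_distrib, ← Finset.mul_sum,
      ← Finset.mul_sum, Finset.sum_const, nsmul_eq_mul]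
    ring
  constructor
  · intro h
    obtain ⟨i, hi⟩ := hs
    rw [Finset.sum_congr rfl fun j hj => by rw [h j hj i hi],
      Finset.sum_congr (f := f) rfl fun j hj => h j hj i hi, Finset.sum_const, Finset.sum_const,
      nsmul_eq_mul, nsmul_eq_mul]
    ring
  · intro h i hi j hj
    rw [h, sub_self, mul_zero, Finset.sum_eq_zero_iff_of_nonneg fun i _ => sq_nonneg _] at h1
    have h2 := pow_eq_zero_iff (two_ne_zero) |>.1 (h1 i hi)
    have h3 := pow_eq_zero_iff (two_ne_zero) |>.1 (h1 j hj)
    exact mul_left_cancel₀ hc.ne' (by linarith)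

/-- A set of `k`-subsets in which each point is in `r` blocks and two blocks meet in `s₁` or `s₂`
points is a `3`-design if and only if its parameters satisfy an equation. -/
theorem exists_isDesign_three_iff {X : Finset P} {B : Finset (Finset P)} {k : ℕ} {r s₁ s₂ : ℝ}
    (hX : 3 ≤ X.card) (hB : ∀ b ∈ B, b ⊆ X) (hk : ∀ b ∈ B, b.card = k)
    (hr : ∀ i ∈ X, ((B.filter fun b => i ∈ b).card : ℝ) = r)
    (hs : ∀ b ∈ B, ∀ c ∈ B, b ≠ c → ((b ∩ c).card : ℝ) = s₁ ∨ ((b ∩ c).card : ℝ) = s₂) :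
    (∃ lam : ℕ, IsDesign 3 X.card k lam X B) ↔
      (X.card : ℝ) * (X.card - 1) * (X.card - 2) * (B.card * (k * (k - 1) * (k - 2) +
        ((s₁ + s₂) ^ 2 - s₁ * s₂ - 3 * (s₁ + s₂) + 2) * (k * (r - 1)) +
          (3 - (s₁ + s₂)) * (s₁ * s₂) * (B.card - 1))) =
        (B.card * (k * (k - 1) * (k - 2) : ℝ)) ^ 2 := by
  set f : Finset P → ℝ := fun T => ((B.filter fun b => T ⊆ b).card : ℝ) with hf
  have hne : (X.powersetCard 3).Nonempty := Finset.powersetCard_nonempty.2 hX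
  have h1 : (∃ lam : ℕ, IsDesign 3 X.card k lam X B) ↔
      ∀ S ∈ X.powersetCard 3, ∀ T ∈ X.powersetCard 3, f S = f T := by
    constructor
    · rintro ⟨lam, h⟩ S hS T hT
      rw [Finset.mem_powersetCard] at hS hT
      simp only [hf, h.card_containing S hS.1 hS.2, h.card_containing T hT.1 hT.2]
    · intro h
      obtain ⟨S, hS⟩ := hne
      refine ⟨(B.filter fun b => S ⊆ b).card, rfl, hB, hk, fun T hT hT3 => ?_⟩
      exact Nat.cast_injective (R := ℝ) (h T (Finset.mem_powersetCard.2 ⟨hT, hT3⟩) S hS)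
  have h2 : 6 * ∑ T ∈ X.powersetCard 3, f T = B.card * (k * (k - 1) * (k - 2) : ℝ) := by
    rw [sum_card_filter_subset hB, Finset.mul_sum,
      Finset.sum_congr rfl fun b hb => by rw [six_mul_choose_three, hk b hb], Finset.sum_const,
      nsmul_eq_mul]
  have h3 : 6 * ∑ T ∈ X.powersetCard 3, f T ^ 2 = B.card * (k * (k - 1) * (k - 2) +
      ((s₁ + s₂) ^ 2 - s₁ * s₂ - 3 * (s₁ + s₂) + 2) * (k * (r - 1)) +
        (3 - (s₁ + s₂)) * (s₁ * s₂) * (B.card - 1)) := by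
    rw [sum_card_filter_subset_sq hB, Finset.mul_sum, ← nsmul_eq_mul, ← Finset.sum_const]
    refine Finset.sum_congr rfl fun b hb => ?_
    -- First moment of the intersection sizes with a fixed block: each of its `k` points lies in `r`
    -- blocks.
    have h4 : ∑ c ∈ B, ((b ∩ c).card : ℝ) = k * r := by
      have h5 : ∀ c ∈ B, ((b ∩ c).card : ℝ) = ∑ i ∈ b, if i ∈ c then (1 : ℝ) else 0 := by
        intro c _
        rw [Finset.sum_boole, Finset.filter_mem_eq_inter]
      rw [Finset.sum_congr rfl h5, Finset.sum_comm,
        Finset.sum_congr rfl fun i hi => by rw [Finset.sum_boole, hr i (hB b hb hi)],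
        Finset.sum_const, nsmul_eq_mul, hk b hb]
    rw [← Finset.add_sum_erase B _ hb, Finset.inter_self, hk b hb] at h4
    rw [Finset.mul_sum, ← Finset.add_sum_erase B _ hb, six_mul_choose_three, Finset.inter_self,
      hk b hb]
    -- The right side is the remainder of `x (x - 1) (x - 2)` modulo `(x - s₁) (x - s₂)`, so only
    -- the first moment is needed.
    have h6 : ∀ c ∈ B.erase b, 6 * ((b ∩ c).card.choose 3 : ℝ) =
        ((s₁ + s₂) ^ 2 - s₁ * s₂ - 3 * (s₁ + s₂) + 2) * (b ∩ c).card +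
          (3 - (s₁ + s₂)) * (s₁ * s₂) := by
      intro c hc
      rw [six_mul_choose_three]
      rcases hs b hb c (Finset.mem_of_mem_erase hc) (Finset.ne_of_mem_erase hc).symm with h | h <;>
        rw [h] <;> ring
    rw [Finset.sum_congr rfl h6, Finset.sum_add_distrib, ← Finset.mul_sum, Finset.sum_const,
      nsmul_eq_mul, Finset.card_erase_of_mem hb, Nat.cast_sub (Finset.card_pos.2 ⟨b, hb⟩),
      Nat.cast_one]
    linear_combination ((s₁ + s₂) ^ 2 - s₁ * s₂ - 3 * (s₁ + s₂) + 2) * h4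
  rw [h1, forall_eq_iff_card_mul_sum_sq _ hne, ← h2, ← h3, ← six_mul_choose_three,
    Finset.card_powersetCard]
  constructor <;> intro h
  · linear_combination 36 * h
  · linear_combination h / 36

end

/-! ### Arithmetic of the parameters -/

section

/-- With `e = s₁ + s₂` and `f = s₁ s₂`, the left side is the Cauchy-Schwarz defect after `b` and `r`
are expressed by `d`, `k`, `ρ` and denominators and common factors are removed. Modulo the quadratic
for `k` it loses its dependence on `k` and factors; the long coefficient is the quotient of that
division. -/
theorem cubic_moment_identity {d k ρ e f : ℝ}
    (he : e = 2 * k - ρ * (ρ - 1) / 2)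
    (hf : f = (k - (ρ - 1) ^ 2 / 4) * (k - (ρ ^ 2 - 1) / 4))
    (hQ : 4 * k ^ 2 - 4 * d * k + (ρ - 1) ^ 2 * (d + ρ) = 0) :
    (d - 2) * (k * (k - 1) * (k - 2) * (ρ ^ 2 - d) +
        (e ^ 2 - f - 3 * e + 2) * (k * (k * (d - 1) - (ρ ^ 2 - d))) +
          (3 - e) * f * (d * (d - 1) - (ρ ^ 2 - d))) - (k * (k - 1) * (k - 2)) ^ 2 =
      (ρ ^ 2 - d - 2) * ((ρ - 1) ^ 2 * (d + ρ) * (ρ ^ 2 - 1) ^ 2) / 64 := by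
  subst he hf
  linear_combination (-k ^ 4 / 4 + k ^ 3 * (6 - d) / 4 +
    k ^ 2 * (8 * d ^ 2 + d * ρ ^ 2 - 2 * d * ρ - 11 * d + ρ ^ 3 - 2 * ρ ^ 2 + ρ - 28) / 16 +
    k * (-2 * d ^ 2 * ρ ^ 2 + d ^ 2 * ρ - 5 * d ^ 2 + d * ρ ^ 3 + 4 * d * ρ ^ 2 - 2 * d * ρ +
      11 * d - 3 * ρ ^ 3 + 3 * ρ) / 8 +
    (2 * d ^ 2 * ρ ^ 4 - 2 * d ^ 2 * ρ ^ 3 + 10 * d ^ 2 * ρ ^ 2 + 2 * d ^ 2 * ρ - 12 * d ^ 2 -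
      2 * d * ρ ^ 5 - d * ρ ^ 4 - 6 * d * ρ ^ 3 - 24 * d * ρ ^ 2 + 8 * d * ρ + 25 * d - ρ ^ 6 +
      4 * ρ ^ 5 + 20 * ρ ^ 3 - ρ ^ 2 - 24 * ρ + 2) / 64) * hQ

/-- The condition for a `3`-design in terms of the angle and the dimension. -/
theorem three_design_equation_iff {d k ρ r b s₁ s₂ : ℝ} (hd : 2 < d) (hρ : 1 < ρ) (hb : 0 < b)
    (hD : ρ ^ 2 - d ≠ 0) (hbD : b * (ρ ^ 2 - d) = d * (d - 1)) (hr : d * r = b * k)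
    (hQ : 4 * k ^ 2 - 4 * d * k + (ρ - 1) ^ 2 * (d + ρ) = 0)
    (hs₁ : s₁ = k - (ρ - 1) ^ 2 / 4) (hs₂ : s₂ = k - (ρ ^ 2 - 1) / 4) :
    d * (d - 1) * (d - 2) * (b * (k * (k - 1) * (k - 2) +
        ((s₁ + s₂) ^ 2 - s₁ * s₂ - 3 * (s₁ + s₂) + 2) * (k * (r - 1)) +
          (3 - (s₁ + s₂)) * (s₁ * s₂) * (b - 1))) = (b * (k * (k - 1) * (k - 2))) ^ 2 ↔
      ρ ^ 2 = d + 2 := by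
  have hrD : r * (ρ ^ 2 - d) = k * (d - 1) := by
    have hd0 : d ≠ 0 := by linarith
    refine mul_left_cancel₀ hd0 ?_
    linear_combination (ρ ^ 2 - d) * hr + k * hbD
  obtain ⟨e, he⟩ : ∃ e, e = s₁ + s₂ := ⟨_, rfl⟩
  obtain ⟨f, hf⟩ : ∃ f, f = s₁ * s₂ := ⟨_, rfl⟩
  rw [← he, ← hf]
  have key := cubic_moment_identity (e := e) (f := f) (by rw [he, hs₁, hs₂]; ring)
    (by rw [hf, hs₁, hs₂]) hQ
  have h1 : 0 < (ρ - 1) ^ 2 * (d + ρ) * (ρ ^ 2 - 1) ^ 2 := by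
    have h2 : 0 < ρ - 1 := by linarith
    have h3 : 0 < ρ ^ 2 - 1 := by nlinarith
    have h4 : 0 < d + ρ := by linarith
    positivity
  have h5 : 0 < b * (d * (d - 1)) := mul_pos hb (mul_pos (by linarith) (by linarith))
  have h6 : (ρ ^ 2 - d) * (d * (d - 1) * (d - 2) * (b * (k * (k - 1) * (k - 2) +
      (e ^ 2 - f - 3 * e + 2) * (k * (r - 1)) + (3 - e) * f * (b - 1))) -
        (b * (k * (k - 1) * (k - 2))) ^ 2) =
      b * (d * (d - 1)) * ((ρ ^ 2 - d - 2) *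
        ((ρ - 1) ^ 2 * (d + ρ) * (ρ ^ 2 - 1) ^ 2) / 64) := by
    rw [← key]
    linear_combination (b * (d * (d - 1)) * (d - 2) * (e ^ 2 - f - 3 * e + 2) * k) * hrD +
      (b * (d * (d - 1)) * (d - 2) * ((3 - e) * f) - b * (k * (k - 1) * (k - 2)) ^ 2) * hbD
  constructor
  · intro h
    rw [h, sub_self, mul_zero, eq_comm, mul_eq_zero, or_iff_right h5.ne', div_eq_zero_iff,
      or_iff_left (by norm_num), mul_eq_zero, or_iff_left h1.ne'] at h6
    linarith
  · intro h
    rw [show ρ ^ 2 - d - 2 = 0 by linarith, zero_mul, zero_div, mul_zero, mul_eq_zero,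
      or_iff_right hD] at h6
    linarith

/-- If there are at most `2 d` lines and `k < d / 2`, the parameters are those of the icosahedron. -/
theorem icosahedral_parameters {d k : ℕ} {ρ b : ℝ} (hd : 2 ≤ d) (hkd : 2 * k < d) (hρ : 1 < ρ)
    (hb : 0 < b) (hbd : b ≤ d) (hbD : b * (ρ ^ 2 - d) = d * (d - 1))
    (hQ : 4 * (k : ℝ) ^ 2 - 4 * d * k + (ρ - 1) ^ 2 * (d + ρ) = 0) :
    d = 3 ∧ k = 1 ∧ ρ = √5 := by
  have hdR : (2 : ℝ) ≤ d := by exact_mod_cast hd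
  have hkR : (2 : ℝ) * k < d := by exact_mod_cast hkd
  have hD : 0 < ρ ^ 2 - d := by
    refine pos_of_mul_pos_right ?_ hb.le
    rw [hbD]
    exact mul_pos (by linarith) (by linarith)
  -- From `b ≤ d` and `b (ρ² - d) = d (d - 1)`.
  have h1 : 2 * (d : ℝ) - 1 ≤ ρ ^ 2 := by
    have h2 : (d : ℝ) * (d - 1) ≤ d * (ρ ^ 2 - d) := by
      rw [← hbD]
      exact mul_le_mul_of_nonneg_right hbd hD.le
    have := le_of_mul_le_mul_left h2 (by linarith)
    linarith
  -- By the quadratic, `(d - 2k)² = (d - ρ² + ρ) (d + ρ - 1)`, and this is positive. With the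
  -- previous bound `ρ > d - 1`, which is incompatible with `d ≥ 4`.
  have h3 : ρ ^ 2 - ρ < d := by
    have h4 : 0 < ((d : ℝ) - ρ ^ 2 + ρ) * (d + ρ - 1) := by
      have : 0 < ((d : ℝ) - 2 * k) ^ 2 := pow_pos (by linarith) 2
      linarith
    have := pos_of_mul_pos_left h4 (by linarith)
    linarith
  have h5 : (d : ℝ) < 4 := by nlinarith
  have hd4 : d < 4 := by exact_mod_cast h5
  have hk0 : k ≠ 0 := by
    rintro rfl
    have : 0 < (ρ - 1) ^ 2 * (d + ρ) := mul_pos (pow_pos (by linarith) 2) (by linarith)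
    simp only [Nat.cast_zero] at hQ
    linarith
  obtain ⟨rfl, rfl⟩ : d = 3 ∧ k = 1 := by omega
  refine ⟨rfl, rfl, ?_⟩
  have h6 : (ρ + 1) * (ρ ^ 2 - 5) = 0 := by
    push_cast at hQ
    linarith
  have h7 : ρ ^ 2 = 5 := by
    rcases mul_eq_zero.1 h6 with h7 | h7 <;> linarith
  rw [← h7, Real.sqrt_sq (by linarith)]

end

/-! ### From equiangular lines to a tight system of unit vectors -/

section

open scoped Classical

open scoped RealInnerProductSpace

variable {d : ℕ}

theorem lineInner_comm (α β : Line d) : lineInner α β = lineInner β α :=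
  real_inner_comm _ _

theorem lineInner_self (α : Line d) : lineInner α α = 1 := by
  rw [lineInner, real_inner_self_eq_norm_sq, norm_unitVec, one_pow]

theorem eq_of_unitVec_eq_smul {α β : Line d} {c : ℝ} (h : unitVec α = c • unitVec β) : α = β := by
  have hα : ‖α.rep‖ ≠ 0 := norm_ne_zero_iff.2 α.rep_nonzero
  rw [← Projectivization.mk_rep α, ← Projectivization.mk_rep β, Projectivization.mk_eq_mk_iff']
  refine ⟨‖α.rep‖ * c * ‖β.rep‖⁻¹, ?_⟩
  rw [unitVec, unitVec, inv_smul_eq_iff₀ hα, smul_smul, smul_smul] at h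
  exact h.symm

theorem abs_lineInner_lt_one {α β : Line d} (h : α ≠ β) : |lineInner α β| < 1 := by
  have h1 : |lineInner α β| ≤ 1 := by
    have := abs_real_inner_le_norm (unitVec α) (unitVec β)
    rwa [norm_unitVec, norm_unitVec, one_mul] at this
  refine lt_of_le_of_ne h1 fun h2 => h ?_
  rcases (abs_eq zero_le_one).1 h2 with h3 | h3
  · have := (inner_eq_one_iff_of_norm_eq_one (norm_unitVec α) (norm_unitVec β)).1 h3
    exact eq_of_unitVec_eq_smul (c := 1) (by rw [this, one_smul])
  · have := (inner_eq_neg_one_iff_of_norm_eq_one (norm_unitVec α) (norm_unitVec β)).1 h3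
    exact eq_of_unitVec_eq_smul (c := -1) (by rw [this, neg_one_smul])

/-- The definition asks for some ordering of the triple; the product is symmetric, so any ordering
may be tested. -/
theorem mem_coherentTriples_iff {Ω : Finset (Line d)} {α β γ : Line d} (hα : α ∈ Ω) (hβ : β ∈ Ω)
    (hγ : γ ∈ Ω) (hαβ : α ≠ β) (hαγ : α ≠ γ) (hβγ : β ≠ γ) :
    ({α, β, γ} : Finset (Line d)) ∈ coherentTriples Ω ↔
      lineInner α β * lineInner β γ * lineInner γ α < 0 := by
  rw [coherentTriples, Finset.mem_filter, Finset.mem_powersetCard]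
  constructor
  · rintro ⟨-, a, b, c, hT, h⟩
    have ha : α ∈ ({a, b, c} : Finset (Line d)) := hT ▸ by simp
    have hb : β ∈ ({a, b, c} : Finset (Line d)) := hT ▸ by simp
    have hc : γ ∈ ({a, b, c} : Finset (Line d)) := hT ▸ by simp
    simp only [Finset.mem_insert, Finset.mem_singleton] at ha hb hc
    have e1 := lineInner_comm a b
    have e2 := lineInner_comm b c
    have e3 := lineInner_comm c a
    rcases ha with rfl | rfl | rfl <;> rcases hb with rfl | rfl | rfl <;>
      rcases hc with rfl | rfl | rfl <;>
      first
        | exact absurd rfl hαβ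
        | exact absurd rfl hαγ
        | exact absurd rfl hβγ
        | (simp only [e1, e2, e3] at h ⊢; linarith)
  · intro h
    refine ⟨⟨?_, Finset.card_eq_three.2 ⟨α, β, γ, hαβ, hαγ, hβγ, rfl⟩⟩, α, β, γ, rfl, h⟩
    intro x hx
    simp only [Finset.mem_insert, Finset.mem_singleton] at hx
    rcases hx with rfl | rfl | rfl <;> assumption

theorem card_of_mem_coherentTriples {Ω T : Finset (Line d)} (hT : T ∈ coherentTriples Ω) :
    T ⊆ Ω ∧ T.card = 3 :=
  Finset.mem_powersetCard.1 (Finset.mem_filter.1 hT).1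

/-- `w` chooses a unit vector on each line. -/
def IsUnitChoice (w : Line d → EuclideanSpace ℝ (Fin d)) : Prop :=
  ∀ α, w α = unitVec α ∨ w α = -unitVec α

namespace IsUnitChoice

variable {w : Line d → EuclideanSpace ℝ (Fin d)}

theorem inner_self (h : IsUnitChoice w) (α : Line d) : ⟪w α, w α⟫ = 1 := by
  rcases h α with h | h <;> simp [h, norm_unitVec]

theorem abs_inner (h : IsUnitChoice w) (α β : Line d) : |⟪w α, w β⟫| = |lineInner α β| := by
  rcases h α with h1 | h1 <;> rcases h β with h2 | h2 <;> simp [h1, h2, lineInner]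

theorem triple (h : IsUnitChoice w) (α β γ : Line d) :
    ⟪w α, w β⟫ * ⟪w β, w γ⟫ * ⟪w γ, w α⟫ =
      lineInner α β * lineInner β γ * lineInner γ α := by
  rcases h α with h1 | h1 <;> rcases h β with h2 | h2 <;> rcases h γ with h3 | h3 <;>
    simp [h1, h2, h3, lineInner]

end IsUnitChoice

/-- Signs for which the vectors of an incoherent set have positive inner products. -/
theorem exists_unitChoice {Ω Γ : Finset (Line d)} {κ : ℝ} (hΩ : IsEquiangular Ω κ) (hΓΩ : Γ ⊆ Ω)
    (hΓ : IsIncoherent (coherentTriples Ω) Γ) (hκ : 0 < κ) :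
    ∃ w, IsUnitChoice w ∧ (∀ i ∈ Γ, ∀ j ∈ Γ, i ≠ j → ⟪w i, w j⟫ = κ) ∧
      ∀ γ, γ ∈ Ω → γ ∉ Γ → 2 * (negSet Γ w γ).card ≤ Γ.card := by
  rcases Γ.eq_empty_or_nonempty with rfl | ⟨o, ho⟩
  · exact ⟨unitVec, fun α => Or.inl rfl, by simp, by simp [negSet]⟩
  -- Signs are normalised against one line `o` of `Γ`; incoherence of the triples through `o` then
  -- makes all inner products within `Γ` positive.
  obtain ⟨v, hvdef⟩ : ∃ v : Line d → EuclideanSpace ℝ (Fin d),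
      v = fun α => if 0 ≤ lineInner o α then unitVec α else -unitVec α := ⟨_, rfl⟩
  have hv : IsUnitChoice v := fun α => by
    rw [hvdef]
    by_cases h : 0 ≤ lineInner o α <;> simp [h]
  have hvo : v o = unitVec o := by simp [hvdef, lineInner_self]
  have hvn : ∀ α, 0 ≤ ⟪v o, v α⟫ := by
    intro α
    rw [hvo, hvdef]
    by_cases h : 0 ≤ lineInner o α
    · simp only [h, if_true]
      exact h
    · simp only [h, if_false, inner_neg_right]
      exact neg_nonneg.2 (not_le.1 h).le
  have hpos : ∀ α ∈ Ω, ∀ β ∈ Ω, α ≠ β → 0 ≤ ⟪v α, v β⟫ → ⟪v α, v β⟫ = κ := by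
    intro α hα β hβ hne h0
    rw [← hΩ α hα β hβ hne, ← hv.abs_inner, abs_of_nonneg h0]
  have hvΓ : ∀ i ∈ Γ, ∀ j ∈ Γ, i ≠ j → ⟪v i, v j⟫ = κ := by
    intro i hi j hj hij
    refine hpos i (hΓΩ hi) j (hΓΩ hj) hij ?_
    by_cases hio : i = o
    · exact hio ▸ hvn j
    by_cases hjo : j = o
    · rw [real_inner_comm]
      exact hjo ▸ hvn i
    have h1 := hpos o (hΓΩ ho) i (hΓΩ hi) (Ne.symm hio) (hvn i)
    have h2 := hpos o (hΓΩ ho) j (hΓΩ hj) (Ne.symm hjo) (hvn j)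
    have h3 := hΓ {o, i, j} (by
      intro x hx
      simp only [Finset.mem_insert, Finset.mem_singleton] at hx
      rcases hx with rfl | rfl | rfl <;> assumption)
      (Finset.card_eq_three.2 ⟨o, i, j, Ne.symm hio, Ne.symm hjo, hij, rfl⟩)
    rw [mem_coherentTriples_iff (hΓΩ ho) (hΓΩ hi) (hΓΩ hj) (Ne.symm hio) (Ne.symm hjo) hij,
      ← hv.triple, h1, real_inner_comm (v o) (v j), h2, not_lt, mul_comm, ← mul_assoc] at h3
    exact nonneg_of_mul_nonneg_right h3 (mul_pos hκ hκ)
  -- Changing the sign of a vector outside `Γ` replaces its negative set by the complement, so the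
  -- smaller one can be chosen.
  obtain ⟨w, hwdef⟩ : ∃ w : Line d → EuclideanSpace ℝ (Fin d),
      w = fun γ => if γ ∈ Γ ∨ 2 * (negSet Γ v γ).card ≤ Γ.card then v γ else -v γ := ⟨_, rfl⟩
  have hwΓ : ∀ i ∈ Γ, w i = v i := fun i hi => by simp [hwdef, hi]
  refine ⟨w, fun α => ?_, fun i hi j hj hij => ?_, fun γ hγΩ hγ => ?_⟩
  · rw [hwdef]
    by_cases h : α ∈ Γ ∨ 2 * (negSet Γ v α).card ≤ Γ.card
    · simpa only [h, if_true] using hv α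
    · simp only [h, if_false]
      rcases hv α with h1 | h1 <;> simp [h1]
  · rw [hwΓ i hi, hwΓ j hj, hvΓ i hi j hj hij]
  · by_cases h : 2 * (negSet Γ v γ).card ≤ Γ.card
    · have : negSet Γ w γ = negSet Γ v γ := by
        refine Finset.filter_congr fun i hi => ?_
        rw [hwΓ i hi, show w γ = v γ by simp [hwdef, h]]
      rwa [this]
    · have h1 : negSet Γ w γ = Γ \ negSet Γ v γ := by
        ext i
        simp only [negSet, Finset.mem_sdiff, Finset.mem_filter, not_and, not_lt]
        refine and_congr_right fun hi => ?_
        rw [hwΓ i hi, show w γ = -v γ by simp [hwdef, h, hγ], inner_neg_right]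
        have h2 := hΩ i (hΓΩ hi) γ hγΩ (by rintro rfl; exact hγ hi)
        rw [← hv.abs_inner] at h2
        constructor
        · intro h3 _
          linarith
        · intro h3
          have h4 : ⟪v i, v γ⟫ ≠ 0 := by
            intro h4
            rw [h4, abs_zero] at h2
            exact hκ.ne h2
          have := lt_of_le_of_ne (h3 hi) h4.symm
          linarith
      rw [h1, Finset.card_sdiff_of_subset (negSet_subset Γ v γ)]
      omega

/-- Here `x`, `y`, `z` are the inner products within a triple of lines. Coherence decides the sign
of `y z` relative to `x`, which is how the two-graph enters the square of the Gram matrix. -/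
theorem mul_eq_of_triple_neg {κ x y z : ℝ} (hκ : 0 < κ) (hx : |x| = κ) (hy : |y| = κ)
    (hz : |z| = κ) (h : x * z * y < 0) : y * z = -(κ * x) := by
  have h3 := pow_pos hκ 3
  rcases (abs_eq hκ.le).1 hx with f1 | f1 <;> rcases (abs_eq hκ.le).1 hy with f2 | f2 <;>
    rcases (abs_eq hκ.le).1 hz with f3 | f3 <;> rw [f1, f2, f3] at h ⊢ <;>
    first | ring1 | (exfalso; linarith)

theorem mul_eq_of_triple_nonneg {κ x y z : ℝ} (hκ : 0 < κ) (hx : |x| = κ) (hy : |y| = κ)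
    (hz : |z| = κ) (h : 0 ≤ x * z * y) : y * z = κ * x := by
  have h3 := pow_pos hκ 3
  rcases (abs_eq hκ.le).1 hx with f1 | f1 <;> rcases (abs_eq hκ.le).1 hy with f2 | f2 <;>
    rcases (abs_eq hκ.le).1 hz with f3 | f3 <;> rw [f1, f2, f3] at h ⊢ <;>
    first | ring1 | (exfalso; linarith)

/-- In a regular two-graph of equiangular lines, the number of lines forming a coherent triple with two
given lines is constant. -/
theorem card_filter_coherent {Ω : Finset (Line d)} {a : ℕ}
    (hdes : IsDesign 2 Ω.card 3 a Ω (coherentTriples Ω)) {α β : Line d} (hα : α ∈ Ω) (hβ : β ∈ Ω)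
    (hαβ : α ≠ β) :
    (((Ω.erase α).erase β).filter fun γ =>
      ({α, β, γ} : Finset (Line d)) ∈ coherentTriples Ω).card = a := by
  rw [← hdes.card_containing {α, β} (by
    intro x hx
    simp only [Finset.mem_insert, Finset.mem_singleton] at hx
    rcases hx with rfl | rfl <;> assumption) (Finset.card_pair hαβ)]
  refine Finset.card_bij (fun γ _ => {α, β, γ}) ?_ ?_ ?_
  · intro γ hγ
    rw [Finset.mem_filter] at hγ ⊢
    refine ⟨hγ.2, fun x hx => ?_⟩
    simp only [Finset.mem_insert, Finset.mem_singleton] at hx ⊢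
    tauto
  · intro γ hγ δ hδ h
    simp only [Finset.mem_filter, Finset.mem_erase] at hγ hδ
    have : γ ∈ ({α, β, δ} : Finset (Line d)) := h ▸ by simp
    simp only [Finset.mem_insert, Finset.mem_singleton] at this
    tauto
  · intro T hT
    rw [Finset.mem_filter] at hT
    obtain ⟨hTΩ, hT3⟩ := card_of_mem_coherentTriples hT.1
    have h1 : (T \ {α, β}).card = 1 := by
      rw [Finset.card_sdiff_of_subset hT.2, hT3, Finset.card_pair hαβ]
    obtain ⟨γ, hγ⟩ := Finset.card_eq_one.1 h1
    have hγT : γ ∈ T \ {α, β} := hγ ▸ Finset.mem_singleton_self γ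
    have hTe : T = {α, β, γ} := by
      rw [← Finset.union_sdiff_of_subset hT.2, hγ]
      ext x
      simp
    simp only [Finset.mem_sdiff, Finset.mem_insert, Finset.mem_singleton, not_or] at hγT
    refine ⟨γ, ?_, hTe.symm⟩
    simp only [Finset.mem_filter, Finset.mem_erase]
    exact ⟨⟨hγT.2.2, hγT.2.1, hTΩ hγT.1⟩, hTe ▸ hT.1⟩

/-- A regular two-graph of equiangular lines is a tight frame. -/
theorem isTightSystem_of_regular {Ω Γ : Finset (Line d)} {κ : ℝ} {a : ℕ}
    {w : Line d → EuclideanSpace ℝ (Fin d)} (hΩ : IsEquiangular Ω κ)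
    (hdes : IsDesign 2 Ω.card 3 a Ω (coherentTriples Ω)) (hΓΩ : Γ ⊆ Ω)
    (hlt : Γ.card < Ω.card) (hw : IsUnitChoice w) (hb : IsSimplexBasis Γ w κ) :
    IsTightSystem Ω Γ w κ := by
  have habs : ∀ α ∈ Ω, ∀ β ∈ Ω, α ≠ β → |⟪w α, w β⟫| = κ := fun α hα β hβ hne => by
    rw [hw.abs_inner, hΩ α hα β hβ hne]
  -- Off the diagonal, `γ = α` and `γ = β` contribute `2 ⟪w α, w β⟫`, and each of the other `n - 2`
  -- lines contributes `±κ ⟪w α, w β⟫`, with the minus sign for `a` of them. The value of `q`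
  -- corrects the diagonal `1 + (n - 1) κ²`.
  obtain ⟨p, hp⟩ : ∃ p : ℝ, p = 2 + κ * (Ω.card - 2 - 2 * a) := ⟨_, rfl⟩
  obtain ⟨q, hq⟩ : ∃ q : ℝ, q = 1 + (Ω.card - 1) * κ ^ 2 - p := ⟨_, rfl⟩
  have hM : ∀ α ∈ Ω, ∀ β ∈ Ω, ∑ γ ∈ Ω, ⟪w γ, w α⟫ * ⟪w γ, w β⟫ =
      p * ⟪w α, w β⟫ + if α = β then q else 0 := by
    intro α hα β hβ
    have hn : ((Ω.erase α).card : ℝ) = Ω.card - 1 := by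
      rw [Finset.card_erase_of_mem hα, Nat.cast_sub (Finset.card_pos.2 ⟨α, hα⟩), Nat.cast_one]
    by_cases hαβ : α = β
    · subst hαβ
      rw [if_pos rfl, ← Finset.add_sum_erase Ω _ hα, hw.inner_self,
        Finset.sum_congr rfl (g := fun _ => κ ^ 2), Finset.sum_const, nsmul_eq_mul, hn, hq]
      · ring
      · intro γ hγ
        rw [← sq, ← sq_abs,
          habs γ (Finset.mem_of_mem_erase hγ) α hα (Finset.ne_of_mem_erase hγ)]
    · have hβ' : β ∈ Ω.erase α := Finset.mem_erase.2 ⟨Ne.symm hαβ, hβ⟩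
      have h1 : ∀ γ ∈ (Ω.erase α).erase β, ⟪w γ, w α⟫ * ⟪w γ, w β⟫ = κ * ⟪w α, w β⟫ *
          (1 - 2 * if ({α, β, γ} : Finset (Line d)) ∈ coherentTriples Ω then (1 : ℝ) else 0) := by
        intro γ hγ
        simp only [Finset.mem_erase] at hγ
        have e1 := habs α hα β hβ hαβ
        have e2 := habs γ hγ.2.2 α hα hγ.2.1
        have e3 := habs γ hγ.2.2 β hβ hγ.1
        have e4 := mem_coherentTriples_iff hα hβ hγ.2.2 hαβ (Ne.symm hγ.2.1) (Ne.symm hγ.1)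
        rw [← hw.triple, real_inner_comm (w γ) (w β)] at e4
        by_cases hc : ({α, β, γ} : Finset (Line d)) ∈ coherentTriples Ω
        · rw [if_pos hc, mul_eq_of_triple_neg hb.pos e1 e2 e3 (e4.1 hc)]
          ring
        · rw [if_neg hc, mul_eq_of_triple_nonneg hb.pos e1 e2 e3 (not_lt.1 fun h => hc (e4.2 h))]
          ring
      rw [if_neg hαβ, ← Finset.add_sum_erase Ω _ hα, ← Finset.add_sum_erase _ _ hβ',
        Finset.sum_congr rfl h1, ← Finset.mul_sum, sum_one_sub_two_mul_ite,
        card_filter_coherent hdes hα hβ hαβ, hw.inner_self, hw.inner_self,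
        Finset.card_erase_of_mem hβ', Nat.cast_sub (Finset.card_pos.2 ⟨β, hβ'⟩), hn,
        real_inner_comm (w α) (w β), hp]
      push_cast
      ring
  obtain ⟨-, ht⟩ := tight_of_gram_sq hb hΓΩ hlt hM
  have hcard := card_eq_of_tight (fun α _ => hw.inner_self α) ht
  refine ⟨hb, hΓΩ, fun α _ => hw.inner_self α, habs, fun x y => ?_⟩
  rw [ht, hcard, hb.card_eq]
  ring

end

/-! ### Recognising the icosahedron -/

section

open scoped Classical

open scoped RealInnerProductSpace

/-- Two bases with the same Gram matrix differ by an isometry. -/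
theorem IsSimplexBasis.exists_isometry {ι E F : Type*} [NormedAddCommGroup E]
    [InnerProductSpace ℝ E] [FiniteDimensional ℝ E] [NormedAddCommGroup F] [InnerProductSpace ℝ F]
    [FiniteDimensional ℝ F] {Γ : Finset ι} {u : ι → E} {w : ι → F} {κ : ℝ}
    (hu : IsSimplexBasis Γ u κ) (hw : IsSimplexBasis Γ w κ) :
    ∃ f : E ≃ₗᵢ[ℝ] F, ∀ i ∈ Γ, f (u i) = w i := by
  obtain ⟨b, hb⟩ : ∃ b : Module.Basis Γ ℝ E, ∀ i, b i = u i :=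
    ⟨Module.Basis.mk hu.linearIndependent hu.span_eq_top.ge, fun i => by simp⟩
  obtain ⟨b', hb'⟩ : ∃ b' : Module.Basis Γ ℝ F, ∀ i, b' i = w i :=
    ⟨Module.Basis.mk hw.linearIndependent hw.span_eq_top.ge, fun i => by simp⟩
  set f : E ≃ₗ[ℝ] F := b.equiv b' (Equiv.refl _) with hf
  have hfu : ∀ i ∈ Γ, f (u i) = w i := by
    intro i hi
    rw [← hb ⟨i, hi⟩, ← hb' ⟨i, hi⟩, hf, Module.Basis.equiv_apply, Equiv.refl_apply]
  refine ⟨f.isometryOfInner fun x y => ?_, hfu⟩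
  obtain ⟨c, rfl⟩ := hu.exists_sum_smul x
  obtain ⟨c', rfl⟩ := hu.exists_sum_smul y
  simp only [map_sum, map_smul]
  rw [sum_inner, sum_inner]
  refine Finset.sum_congr rfl fun i hi => ?_
  rw [inner_sum, inner_sum]
  refine Finset.sum_congr rfl fun j hj => ?_
  rw [real_inner_smul_left, real_inner_smul_left, inner_smul_right, inner_smul_right, hfu i hi,
    hfu j hj]
  by_cases hij : i = j
  · subst hij
    rw [hu.inner_self i hi, hw.inner_self i hi]
  · rw [hu.inner_of_ne i hi j hj hij, hw.inner_of_ne i hi j hj hij]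

/-- Three vertices of the icosahedron that form a face. -/
noncomputable def faceVertex : Fin 3 → EuclideanSpace ℝ (Fin 3) :=
  ![!₂[0, 1, Real.goldenRatio], !₂[1, Real.goldenRatio, 0], !₂[Real.goldenRatio, 0, 1]]

/-- The vertices adjacent to exactly two vertices of the face. -/
noncomputable def nextVertex : Fin 3 → EuclideanSpace ℝ (Fin 3) :=
  ![!₂[Real.goldenRatio, 0, -1], !₂[0, -1, Real.goldenRatio], !₂[-1, Real.goldenRatio, 0]]

theorem inner_fin_three (x y : EuclideanSpace ℝ (Fin 3)) :
    ⟪x, y⟫ = x 0 * y 0 + x 1 * y 1 + x 2 * y 2 := by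
  simp only [PiLp.inner_apply, Fin.sum_univ_three, Real.inner_apply]

theorem inner_faceVertex (i j : Fin 3) :
    ⟪faceVertex i, faceVertex j⟫ =
      if i = j then Real.goldenRatio + 2 else Real.goldenRatio := by
  have h := Real.goldenRatio_sq
  rw [inner_fin_three]
  fin_cases i <;> fin_cases j <;> simp [faceVertex] <;> linarith

theorem inner_faceVertex_nextVertex (i j : Fin 3) :
    ⟪faceVertex i, nextVertex j⟫ =
      if i = j then -Real.goldenRatio else Real.goldenRatio := by
  have h := Real.goldenRatio_sq
  rw [inner_fin_three]
  fin_cases i <;> fin_cases j <;> simp [faceVertex, nextVertex] <;> linarith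

theorem faceVertex_mem (i : Fin 3) : faceVertex i ∈ icosahedronVertices := by
  refine ⟨1, 1, Or.inl rfl, Or.inl rfl, ?_⟩
  fin_cases i <;> simp [faceVertex]

theorem nextVertex_mem (i : Fin 3) : nextVertex i ∈ icosahedronVertices := by
  refine ⟨-1, 1, Or.inr rfl, Or.inl rfl, ?_⟩
  fin_cases i <;> simp [nextVertex]

/-- The vertices of one face and those adjacent to exactly two of them represent all six antipodal
pairs. -/
theorem exists_eq_faceVertex_or_nextVertex {v : EuclideanSpace ℝ (Fin 3)}
    (hv : v ∈ icosahedronVertices) :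
    ∃ i, ∃ a : ℝ, a ≠ 0 ∧ (v = a • faceVertex i ∨ v = a • nextVertex i) := by
  have key : ∀ (i : Fin 3) (a : ℝ), (a = 1 ∨ a = -1) →
      (v = a • faceVertex i ∨ v = a • nextVertex i) →
      ∃ i, ∃ a : ℝ, a ≠ 0 ∧ (v = a • faceVertex i ∨ v = a • nextVertex i) := by
    rintro i a ha h
    exact ⟨i, a, by rcases ha with rfl | rfl <;> norm_num, h⟩
  obtain ⟨s, t, hs, ht, rfl | rfl | rfl⟩ := hv
  · rcases hs with rfl | rfl <;> rcases ht with rfl | rfl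
    · exact key 0 1 (by simp) (Or.inl (by ext l; fin_cases l <;> simp [faceVertex]))
    · exact key 1 (-1) (by simp) (Or.inr (by ext l; fin_cases l <;> simp [nextVertex]))
    · exact key 1 1 (by simp) (Or.inr (by ext l; fin_cases l <;> simp [nextVertex]))
    · exact key 0 (-1) (by simp) (Or.inl (by ext l; fin_cases l <;> simp [faceVertex]))
  · rcases hs with rfl | rfl <;> rcases ht with rfl | rfl
    · exact key 1 1 (by simp) (Or.inl (by ext l; fin_cases l <;> simp [faceVertex]))
    · exact key 2 (-1) (by simp) (Or.inr (by ext l; fin_cases l <;> simp [nextVertex]))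
    · exact key 2 1 (by simp) (Or.inr (by ext l; fin_cases l <;> simp [nextVertex]))
    · exact key 1 (-1) (by simp) (Or.inl (by ext l; fin_cases l <;> simp [faceVertex]))
  · rcases hs with rfl | rfl <;> rcases ht with rfl | rfl
    · exact key 2 1 (by simp) (Or.inl (by ext l; fin_cases l <;> simp [faceVertex]))
    · exact key 0 (-1) (by simp) (Or.inr (by ext l; fin_cases l <;> simp [nextVertex]))
    · exact key 0 1 (by simp) (Or.inr (by ext l; fin_cases l <;> simp [nextVertex]))
    · exact key 2 (-1) (by simp) (Or.inl (by ext l; fin_cases l <;> simp [faceVertex]))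

/-- The face vertices have square norm `φ + 2` and pairwise inner product `φ`, so this makes their
cosine `1 / √5`. -/
theorem goldenRatio_add_two : Real.goldenRatio + 2 = √5 * Real.goldenRatio := by
  have h : √5 * √5 = 5 := Real.mul_self_sqrt (by norm_num)
  rw [Real.goldenRatio]
  linear_combination -h / 2

theorem isSimplexBasis_faceVertex : IsSimplexBasis Finset.univ
    (fun i => (√(Real.goldenRatio + 2))⁻¹ • faceVertex i) (√5)⁻¹ := by
  have hφ := Real.goldenRatio_pos
  have h5 : (1 : ℝ) < √5 := Real.lt_sqrt (by norm_num) |>.2 (by norm_num)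
  have hc : √(Real.goldenRatio + 2) * √(Real.goldenRatio + 2) = Real.goldenRatio + 2 :=
    Real.mul_self_sqrt (by linarith)
  refine ⟨inv_pos.2 (by linarith), inv_lt_one_of_one_lt₀ h5, ?_, ?_, by simp⟩
  · intro i _
    rw [real_inner_smul_left, inner_smul_right, inner_faceVertex, if_pos rfl, ← mul_assoc,
      ← mul_inv, hc, inv_mul_cancel₀ (by linarith)]
  · intro i _ j _ hij
    rw [real_inner_smul_left, inner_smul_right, inner_faceVertex, if_neg hij, ← mul_assoc,
      ← mul_inv, hc, goldenRatio_add_two]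
    field_simp

theorem IsUnitChoice.submodule_eq {d : ℕ} {w : Line d → EuclideanSpace ℝ (Fin d)}
    (h : IsUnitChoice w) (α : Line d) : α.submodule = Submodule.span ℝ {w α} := by
  have hα : ‖α.rep‖ ≠ 0 := norm_ne_zero_iff.2 α.rep_nonzero
  have h1 : α.submodule = Submodule.span ℝ {unitVec α} := by
    rw [Projectivization.submodule_eq, unitVec,
      Submodule.span_singleton_smul_eq (inv_ne_zero hα).isUnit]
  rcases h α with h2 | h2
  · rw [h1, h2]
  · rw [h1, h2, ← neg_one_smul ℝ (unitVec α), Submodule.span_singleton_smul_eq (by simp)]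

theorem IsUnitChoice.map_eq {d : ℕ} {w : Line d → EuclideanSpace ℝ (Fin d)} (h : IsUnitChoice w)
    (f : EuclideanSpace ℝ (Fin 3) ≃ₗᵢ[ℝ] EuclideanSpace ℝ (Fin d)) {ℓ : Line 3}
    {v : EuclideanSpace ℝ (Fin 3)} (hℓ : ℓ.submodule = Submodule.span ℝ {v}) {α : Line d} {a : ℝ}
    (ha : a ≠ 0) (hv : f v = a • w α) :
    Projectivization.map f.toLinearEquiv.toLinearMap f.injective ℓ = α := by
  have hv0 : v ≠ 0 := by
    rintro rfl
    rw [map_zero, eq_comm, smul_eq_zero, or_iff_right ha] at hv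
    have := h.inner_self α
    simp [hv] at this
  have h1 : ℓ = Projectivization.mk ℝ v hv0 :=
    Projectivization.submodule_injective (by rw [hℓ, Projectivization.submodule_mk])
  rw [h1, Projectivization.map_mk]
  apply Projectivization.submodule_injective
  rw [Projectivization.submodule_mk, h.submodule_eq]
  change Submodule.span ℝ {f v} = _
  rw [hv, Submodule.span_singleton_smul_eq ha.isUnit]

/-- The six lines of the icosahedron are determined by their parameters. -/
theorem isIcosahedral_of_parameters {Ω Γ : Finset (Line 3)} {κ : ℝ}
    {w : Line 3 → EuclideanSpace ℝ (Fin 3)} (hw : IsUnitChoice w) (h : IsTightSystem Ω Γ w κ)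
    (hκ : κ = (√5)⁻¹) (hΓ : Γ.card = 3) (hΩ : (Ω \ Γ).card = 3)
    (hk : ∀ γ ∈ Ω \ Γ, (negSet Γ w γ).card = 1) : IsIcosahedral Ω := by
  obtain ⟨x, y, z, hxy, hxz, hyz, hxyz⟩ := Finset.card_eq_three.1 hΓ
  obtain ⟨g, hg⟩ : ∃ g : Fin 3 → Line 3, g = ![x, y, z] := ⟨_, rfl⟩
  have hgΓ : ∀ i, g i ∈ Γ := by
    intro i
    rw [hg, hxyz]
    fin_cases i <;> simp
  have hgi : ∀ i j, i ≠ j → g i ≠ g j := by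
    intro i j hij
    rw [hg]
    fin_cases i <;> fin_cases j <;> first | exact absurd rfl hij | (simp; tauto)
  have hgs : ∀ α ∈ Γ, ∃ i, α = g i := by
    intro α hα
    rw [hxyz] at hα
    simp only [Finset.mem_insert, Finset.mem_singleton] at hα
    rcases hα with rfl | rfl | rfl
    · exact ⟨0, by simp [hg]⟩
    · exact ⟨1, by simp [hg]⟩
    · exact ⟨2, by simp [hg]⟩
  -- Three lines have distinct one-point negative sets in a set of three points, so each singleton
  -- occurs.
  have himage : (Ω \ Γ).image (negSet Γ w) = Γ.powersetCard 1 := by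
    refine Finset.eq_of_subset_of_card_le ?_ ?_
    · intro S hS
      obtain ⟨γ, hγ, rfl⟩ := Finset.mem_image.1 hS
      exact Finset.mem_powersetCard.2 ⟨negSet_subset Γ w γ, hk γ hγ⟩
    · rw [Finset.card_image_of_injOn h.injOn_negSet, Finset.card_powersetCard, hΓ, hΩ]
      rfl
  have hex : ∀ i, ∃ γ ∈ Ω \ Γ, negSet Γ w γ = {g i} := by
    intro i
    have : ({g i} : Finset (Line 3)) ∈ (Ω \ Γ).image (negSet Γ w) := by
      rw [himage]
      exact Finset.mem_powersetCard.2 ⟨Finset.singleton_subset_iff.2 (hgΓ i), rfl⟩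
    exact Finset.mem_image.1 this
  choose q hq hqn using hex
  have hb : IsSimplexBasis Finset.univ (fun i => w (g i)) (√5)⁻¹ :=
    ⟨hκ ▸ h.basis.pos, hκ ▸ h.basis.lt_one, fun i _ => h.basis.inner_self _ (hgΓ i),
      fun i _ j _ hij => hκ ▸ h.basis.inner_of_ne _ (hgΓ i) _ (hgΓ j) (hgi i j hij), by simp⟩
  obtain ⟨f, hf⟩ := isSimplexBasis_faceVertex.exists_isometry hb
  have hφ := Real.goldenRatio_pos
  obtain ⟨c, hcdef⟩ : ∃ c, c = √(Real.goldenRatio + 2) := ⟨_, rfl⟩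
  rw [← hcdef] at hf
  have hc0 : c ≠ 0 := hcdef ▸ (Real.sqrt_pos.2 (by linarith)).ne'
  have hc : c * c = √5 * Real.goldenRatio := by
    rw [hcdef, Real.mul_self_sqrt (by linarith), goldenRatio_add_two]
  have h5 : √5 ≠ 0 := by positivity
  have hface : ∀ i, f (faceVertex i) = c • w (g i) := by
    intro i
    rw [← hf i (Finset.mem_univ i), map_smul, smul_smul, mul_inv_cancel₀ hc0, one_smul]
  -- Both sides have the same inner products with the basis, whose vectors come from the face
  -- vertices.
  have hnext : ∀ i, f (nextVertex i) = c • w (q i) := by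
    intro i
    refine h.basis.ext_inner fun α hα => ?_
    obtain ⟨j, rfl⟩ := hgs α hα
    rw [inner_smul_right, h.inner_eq_ite (hq i) (hgΓ j), hqn i,
      ← hf j (Finset.mem_univ j), LinearIsometryEquiv.inner_map_map, real_inner_smul_left,
      inner_faceVertex_nextVertex, hκ]
    by_cases hij : j = i
    · subst hij
      rw [if_pos rfl, if_pos (Finset.mem_singleton_self _)]
      field_simp
      linear_combination 2 * hc
    · rw [if_neg hij, if_neg fun hm => hgi j i hij (Finset.mem_singleton.1 hm)]
      field_simp
      linear_combination -2 * hc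
  have hgΩ : ∀ i, g i ∈ Ω := fun i => h.subset (hgΓ i)
  have hqΩ : ∀ i, q i ∈ Ω := fun i => (Finset.mem_sdiff.1 (hq i)).1
  have hline : ∀ v : EuclideanSpace ℝ (Fin 3), v ∈ icosahedronVertices → ∀ α, f v = c • w α →
      ∃ ℓ ∈ icosahedralLines,
        Projectivization.map f.toLinearEquiv.toLinearMap f.injective ℓ = α := by
    intro v hv α hα
    have hv0 : v ≠ 0 := by
      rintro rfl
      rw [map_zero, eq_comm, smul_eq_zero, or_iff_right hc0] at hα
      have := hw.inner_self α
      simp [hα] at this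
    exact ⟨Projectivization.mk ℝ v hv0, ⟨v, hv, Projectivization.submodule_mk v hv0⟩,
      hw.map_eq f (Projectivization.submodule_mk v hv0) hc0 hα⟩
  refine ⟨f, Set.Subset.antisymm ?_ ?_⟩
  · intro α hα
    by_cases hαΓ : α ∈ Γ
    · obtain ⟨i, rfl⟩ := hgs α hαΓ
      exact hline _ (faceVertex_mem i) _ (hface i)
    · have hα' : α ∈ Ω \ Γ := Finset.mem_sdiff.2 ⟨hα, hαΓ⟩
      obtain ⟨β, hβ⟩ := Finset.card_eq_one.1 (hk α hα')
      have hβΓ : β ∈ Γ := negSet_subset Γ w α (hβ ▸ Finset.mem_singleton_self β)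
      obtain ⟨i, rfl⟩ := hgs β hβΓ
      rw [h.injOn_negSet (Finset.mem_coe.2 hα') (Finset.mem_coe.2 (hq i)) (hβ.trans (hqn i).symm)]
      exact hline _ (nextVertex_mem i) _ (hnext i)
  · rintro _ ⟨ℓ, ⟨v, hv, hℓ⟩, rfl⟩
    obtain ⟨i, a, ha, hva | hva⟩ := exists_eq_faceVertex_or_nextVertex hv
    · rw [hw.map_eq f hℓ (mul_ne_zero ha hc0) (by rw [hva, map_smul, hface, smul_smul])]
      exact hgΩ i
    · rw [hw.map_eq f hℓ (mul_ne_zero ha hc0) (by rw [hva, map_smul, hnext, smul_smul])]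
      exact hqΩ i

end

/-! ### The blocks as a quasi-symmetric design -/

section

open scoped Classical

open scoped RealInnerProductSpace

/-- As `⟪w α, w δ⟫ = κ > 0` within `Γ`, the triple `γ`, `α`, `δ` is coherent exactly when `γ` has
opposite signs at `α` and `δ`. For `δ = α` the set has only two elements, in agreement with equal
signs. -/
theorem splitSet_eq {d : ℕ} {Ω Γ : Finset (Line d)} {κ : ℝ}
    {w : Line d → EuclideanSpace ℝ (Fin d)} (hw : IsUnitChoice w) (h : IsTightSystem Ω Γ w κ)
    {γ α : Line d} (hγ : γ ∈ Ω \ Γ) (hα : α ∈ Γ) :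
    splitSet (coherentTriples Ω) Γ γ α =
      if α ∈ negSet Γ w γ then Γ \ negSet Γ w γ else negSet Γ w γ := by
  obtain ⟨hγΩ, hγΓ⟩ := Finset.mem_sdiff.1 hγ
  have hκ := h.basis.pos
  have hκ3 := pow_pos hκ 3
  have key : ∀ δ ∈ Γ, (({γ, α, δ} : Finset (Line d)) ∈ coherentTriples Ω ↔
      ((α ∈ negSet Γ w γ ∧ δ ∉ negSet Γ w γ) ∨ (α ∉ negSet Γ w γ ∧ δ ∈ negSet Γ w γ))) := by
    intro δ hδ
    by_cases hαδ : α = δ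
    · subst hαδ
      refine iff_of_false (fun hT => ?_) (by tauto)
      have h1 := (card_of_mem_coherentTriples hT).2
      rw [Finset.pair_eq_singleton] at h1
      have h2 := Finset.card_le_two (a := γ) (b := α)
      omega
    · rw [mem_coherentTriples_iff hγΩ (h.subset hα) (h.subset hδ)
        (by rintro rfl; exact hγΓ hα) (by rintro rfl; exact hγΓ hδ) hαδ, ← hw.triple,
        h.basis.inner_of_ne α hα δ hδ hαδ, real_inner_comm, h.inner_eq_ite hγ hα,
        h.inner_eq_ite hγ hδ]
      by_cases h1 : α ∈ negSet Γ w γ <;> by_cases h2 : δ ∈ negSet Γ w γ <;>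
        simp only [h1, h2, if_true, if_false, not_true, not_false_iff, and_self, and_false,
          false_and, or_false, or_true, or_self, iff_true, iff_false, not_lt] <;> linarith
  ext δ
  rw [splitSet, Finset.mem_filter]
  by_cases hδ : δ ∈ Γ
  · rw [key δ hδ]
    by_cases h1 : α ∈ negSet Γ w γ <;> simp [h1, hδ]
  · refine iff_of_false (fun hm => hδ hm.1) ?_
    split_ifs
    · exact fun hm => hδ (Finset.mem_sdiff.1 hm).1
    · exact fun hm => hδ (negSet_subset Γ w γ hm)

/-- The split consists of `negSet Γ w γ` and its complement; as the former has at most half of the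
points, the labelling by size is ambiguous only when both have exactly half. -/
theorem IsSplit.eq_negSet {d : ℕ} {Ω Γ : Finset (Line d)} {κ : ℝ}
    {w : Line d → EuclideanSpace ℝ (Fin d)} (hw : IsUnitChoice w) (h : IsTightSystem Ω Γ w κ)
    {γ : Line d} (hγ : γ ∈ Ω \ Γ) {S₁ S₂ : Finset (Line d)}
    (hS : IsSplit (coherentTriples Ω) Γ γ S₁ S₂) (hN : 2 * (negSet Γ w γ).card ≤ Γ.card) :
    2 * S₁.card ≤ Γ.card ∧ (S₁ = negSet Γ w γ ∨ 2 * (negSet Γ w γ).card = Γ.card ∧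
      2 * S₁.card = Γ.card) := by
  obtain ⟨α₁, h₁, α₂, h₂, hC, rfl, rfl, hle⟩ := hS
  have hm : α₂ ∈ splitSet (coherentTriples Ω) Γ γ α₁ := Finset.mem_filter.2 ⟨h₂, hC⟩
  have hsub := Finset.card_sdiff_of_subset (negSet_subset Γ w γ)
  have hcard := Finset.card_le_card (negSet_subset Γ w γ)
  rw [splitSet_eq hw h hγ h₁] at hm hle ⊢
  rw [splitSet_eq hw h hγ h₂] at hle
  by_cases hα : α₁ ∈ negSet Γ w γ
  · rw [if_pos hα] at hm hle ⊢
    rw [if_neg (Finset.mem_sdiff.1 hm).2] at hle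
    omega
  · rw [if_neg hα] at hm hle ⊢
    exact ⟨hN, Or.inl rfl⟩

namespace IsTightSystem

variable {ι E : Type*} [NormedAddCommGroup E] [InnerProductSpace ℝ E]
  {Ω Γ : Finset ι} {w : ι → E} {κ : ℝ}

theorem card_sdiff_mul (h : IsTightSystem Ω Γ w κ) (hne : (Ω \ Γ).Nonempty) :
    ((Ω \ Γ).card : ℝ) * (κ⁻¹ ^ 2 - Γ.card) = Γ.card * (Γ.card - 1) := by
  obtain ⟨γ, hγ⟩ := hne
  have h1 := h.card_mul (Finset.mem_sdiff.1 hγ).1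
  rw [Finset.card_sdiff_of_subset h.subset, Nat.cast_sub (Finset.card_le_card h.subset)]
  linear_combination h1

/-- If there are more than `2 d` vectors, those outside the basis do not form a simplex with negative
inner products. -/
theorem exists_inner_eq (h : IsTightSystem Ω Γ w κ) (hd : 2 ≤ Γ.card)
    (hlt : Γ.card < (Ω \ Γ).card) :
    ∃ γ ∈ Ω \ Γ, ∃ δ ∈ Ω \ Γ, γ ≠ δ ∧ ⟪w γ, w δ⟫ = κ := by
  by_contra! hcon
  have hκ := h.basis.pos
  have hneg : ∀ γ ∈ Ω \ Γ, ∀ δ ∈ Ω \ Γ, γ ≠ δ → ⟪w γ, w δ⟫ = -κ := by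
    intro γ hγ δ hδ hne
    have h1 := h.abs_inner γ (Finset.mem_sdiff.1 hγ).1 δ (Finset.mem_sdiff.1 hδ).1 hne
    exact ((abs_eq hκ.le).1 h1).resolve_left (hcon γ hγ δ hδ hne)
  have hpos : 0 < (Ω \ Γ).card := by omega
  obtain ⟨b, hb⟩ : ∃ b : ℝ, b = ((Ω \ Γ).card : ℝ) := ⟨_, rfl⟩
  -- If all inner products were `-κ`, this square norm would be `b (1 - κ (b - 1))`, whence `b - 1 ≤
  -- κ⁻¹`.
  have h2 : 0 ≤ ⟪∑ γ ∈ Ω \ Γ, w γ, ∑ γ ∈ Ω \ Γ, w γ⟫ := real_inner_self_nonneg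
  have h3 : ∀ γ ∈ Ω \ Γ, ⟪w γ, ∑ δ ∈ Ω \ Γ, w δ⟫ = 1 - κ * (b - 1) := by
    intro γ hγ
    rw [inner_sum, ← Finset.add_sum_erase _ _ hγ, h.inner_self γ (Finset.mem_sdiff.1 hγ).1,
      Finset.sum_congr rfl fun δ hδ => hneg γ hγ δ (Finset.mem_of_mem_erase hδ)
        (Finset.ne_of_mem_erase hδ).symm, Finset.sum_const, nsmul_eq_mul,
      Finset.card_erase_of_mem hγ, Nat.cast_sub hpos, hb]
    push_cast
    ring
  rw [sum_inner, Finset.sum_congr rfl h3, Finset.sum_const, nsmul_eq_mul, ← hb] at h2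
  have hb0 : 0 < b := hb ▸ Nat.cast_pos.2 hpos
  have h4 : 0 ≤ 1 - κ * (b - 1) := nonneg_of_mul_nonneg_right h2 hb0
  have h5 : b - 1 ≤ κ⁻¹ := by
    rw [← one_div, le_div_iff₀ hκ]
    linarith
  have hdR : (2 : ℝ) ≤ Γ.card := by exact_mod_cast hd
  have hbd : (Γ.card : ℝ) + 1 ≤ b := by
    rw [hb]
    exact_mod_cast hlt
  have h6 := h.card_sdiff_mul (Finset.card_pos.1 hpos)
  rw [← hb] at h6
  -- Now `d ≤ b - 1 ≤ κ⁻¹`, so `κ⁻¹² - d` is at least `d (d - 1) > 0`; as `b > 1`, the product `b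
  -- (κ⁻¹² - d)` exceeds its value `d (d - 1)`.
  have h7 : (Γ.card : ℝ) ^ 2 ≤ κ⁻¹ ^ 2 := pow_le_pow_left₀ (by linarith) (by linarith) 2
  have h8 : (Γ.card : ℝ) * (Γ.card - 1) ≤ κ⁻¹ ^ 2 - Γ.card := by linarith
  have h9 : (0 : ℝ) < Γ.card * (Γ.card - 1) := mul_pos (by linarith) (by linarith)
  have h10 : 1 * (κ⁻¹ ^ 2 - Γ.card) < b * (κ⁻¹ ^ 2 - Γ.card) :=
    mul_lt_mul_of_pos_right (by linarith) (by linarith)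
  linarith

variable [FiniteDimensional ℝ E]

theorem negSet_nonempty (h : IsTightSystem Ω Γ w κ) {γ : ι} (hγ : γ ∈ Ω \ Γ) :
    0 < (negSet Γ w γ).card := by
  by_contra h0
  have h1 := h.quadratic hγ
  have hρ := h.one_lt_inv
  rw [Nat.eq_zero_of_not_pos h0] at h1
  have : 0 < (κ⁻¹ - 1) ^ 2 * (Γ.card + κ⁻¹) :=
    mul_pos (pow_pos (by linarith) 2) (by positivity)
  norm_num at h1
  rcases h1 with h1 | h1
  · linarith
  · have := h.basis.pos
    have : (0 : ℝ) < Γ.card + κ⁻¹ := by positivity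
    linarith

theorem card_negSet_eq (h : IsTightSystem Ω Γ w κ) {γ δ : ι} (hγ : γ ∈ Ω \ Γ) (hδ : δ ∈ Ω \ Γ)
    (hγN : 2 * (negSet Γ w γ).card ≤ Γ.card) (hδN : 2 * (negSet Γ w δ).card ≤ Γ.card) :
    (negSet Γ w γ).card = (negSet Γ w δ).card := by
  have h1 := h.quadratic hγ
  have h2 := h.quadratic hδ
  have h3 : (2 : ℝ) * (negSet Γ w γ).card ≤ Γ.card := by exact_mod_cast hγN
  have h4 : (2 : ℝ) * (negSet Γ w δ).card ≤ Γ.card := by exact_mod_cast hδN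
  have h5 : ((Γ.card : ℝ) - 2 * (negSet Γ w γ).card) ^ 2 =
      ((Γ.card : ℝ) - 2 * (negSet Γ w δ).card) ^ 2 := by linear_combination h1 - h2
  have h6 := (pow_left_inj₀ (by linarith) (by linarith) two_ne_zero).1 h5
  have h7 : ((negSet Γ w γ).card : ℝ) = (negSet Γ w δ).card := by linarith
  exact_mod_cast h7

/-- Distinct lines give distinct blocks, so counts of lines are counts of blocks. -/
theorem card_filter_image (h : IsTightSystem Ω Γ w κ) (p : Finset ι → Prop)
    [DecidablePred p] :
    (((Ω \ Γ).image (negSet Γ w)).filter p).card =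
      ((Ω \ Γ).filter fun γ => p (negSet Γ w γ)).card := by
  rw [Finset.filter_image, Finset.card_image_of_injOn]
  exact h.injOn_negSet.mono fun γ hγ => Finset.mem_coe.2 (Finset.mem_filter.1 hγ).1

/-- The sets `negSet Γ w γ` form a quasi-symmetric design. -/
theorem exists_isQuasiSymmetric (h : IsTightSystem Ω Γ w κ) {v k : ℕ} (hv : Γ.card = v)
    (hk : ∀ γ ∈ Ω \ Γ, (negSet Γ w γ).card = k) (hkv : 2 * k < v)
    (hlt : v < (Ω \ Γ).card)
    (hneg : ∃ γ ∈ Ω \ Γ, ∃ δ ∈ Ω \ Γ, γ ≠ δ ∧ ⟪w γ, w δ⟫ = -κ) :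
    2 * v < Ω.card ∧ ∃ k lam s₁ s₂ : ℕ,
      IsQuasiSymmetric 2 v k lam s₁ s₂ Γ ((Ω \ Γ).image (negSet Γ w)) ∧
      4 * (k : ℝ) ^ 2 - 4 * (v : ℝ) * (k : ℝ) + (κ⁻¹ - 1) ^ 2 * ((v : ℝ) + κ⁻¹) = 0 ∧
      κ⁻¹ ^ 2 - (v : ℝ) ≠ 0 ∧
      (lam : ℝ) = (k : ℝ) * ((k : ℝ) - 1) / (κ⁻¹ ^ 2 - (v : ℝ)) ∧
      (s₁ : ℝ) = (k : ℝ) - (κ⁻¹ - 1) ^ 2 / 4 ∧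
      (s₂ : ℝ) = (k : ℝ) - (κ⁻¹ ^ 2 - 1) / 4 ∧
      ((Ω.card : ℝ) = (v : ℝ) * ((v : ℝ) + 1) / 2 ↔
        ∃ lam₃ : ℕ, IsDesign 3 v k lam₃ Γ ((Ω \ Γ).image (negSet Γ w))) := by
  subst hv
  have hpos : 0 < (Ω \ Γ).card := by omega
  obtain ⟨γ₀, hγ₀⟩ := Finset.card_pos.1 hpos
  have hk0 : 0 < k := hk γ₀ hγ₀ ▸ h.negSet_nonempty hγ₀
  have hd3 : 3 ≤ Γ.card := by omega
  have hdR : (3 : ℝ) ≤ Γ.card := by exact_mod_cast hd3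
  have hρ := h.one_lt_inv
  have hκ := h.basis.pos
  have hbD := h.card_sdiff_mul ⟨γ₀, hγ₀⟩
  have hQ := h.quadratic hγ₀
  rw [hk γ₀ hγ₀] at hQ
  have hb0 : (0 : ℝ) < (Ω \ Γ).card := Nat.cast_pos.2 hpos
  have hD : κ⁻¹ ^ 2 - (Γ.card : ℝ) ≠ 0 := by
    intro h0
    rw [h0, mul_zero] at hbD
    have : (0 : ℝ) < Γ.card * (Γ.card - 1) := mul_pos (by linarith) (by linarith)
    linarith
  have hn : ((Ω \ Γ).card : ℝ) = Ω.card - Γ.card := by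
    rw [Finset.card_sdiff_of_subset h.subset, Nat.cast_sub (Finset.card_le_card h.subset)]
  have hinter : ∀ γ ∈ Ω \ Γ, ∀ δ ∈ Ω \ Γ, (κ⁻¹ - 1) * κ⁻¹ * (1 - ⟪w γ, w δ⟫) =
      4 * (k - ((negSet Γ w γ ∩ negSet Γ w δ).card : ℝ)) := by
    intro γ hγ δ hδ
    rw [h.inner_eq_card_inter hγ hδ (by rw [hk γ hγ, hk δ hδ]), hk γ hγ]
  have hinter₁ : ∀ γ ∈ Ω \ Γ, ∀ δ ∈ Ω \ Γ, ⟪w γ, w δ⟫ = κ →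
      ((negSet Γ w γ ∩ negSet Γ w δ).card : ℝ) = k - (κ⁻¹ - 1) ^ 2 / 4 := by
    intro γ hγ δ hδ he
    have h1 := hinter γ hγ δ hδ
    have h2 : κ⁻¹ * κ = 1 := inv_mul_cancel₀ hκ.ne'
    rw [he] at h1
    linear_combination h1 / 4 + (κ⁻¹ - 1) / 4 * h2
  have hinter₂ : ∀ γ ∈ Ω \ Γ, ∀ δ ∈ Ω \ Γ, ⟪w γ, w δ⟫ = -κ →
      ((negSet Γ w γ ∩ negSet Γ w δ).card : ℝ) = k - (κ⁻¹ ^ 2 - 1) / 4 := by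
    intro γ hγ δ hδ he
    have h1 := hinter γ hγ δ hδ
    have h2 : κ⁻¹ * κ = 1 := inv_mul_cancel₀ hκ.ne'
    rw [he] at h1
    linear_combination h1 / 4 - (κ⁻¹ - 1) / 4 * h2
  obtain ⟨γ₁, hγ₁, δ₁, hδ₁, hne₁, he₁⟩ := h.exists_inner_eq (by omega) hlt
  obtain ⟨γ₂, hγ₂, δ₂, hδ₂, hne₂, he₂⟩ := hneg
  obtain ⟨s₁, hs₁⟩ : ∃ s, s = (negSet Γ w γ₁ ∩ negSet Γ w δ₁).card := ⟨_, rfl⟩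
  obtain ⟨s₂, hs₂⟩ : ∃ s, s = (negSet Γ w γ₂ ∩ negSet Γ w δ₂).card := ⟨_, rfl⟩
  have hs₁R : (s₁ : ℝ) = k - (κ⁻¹ - 1) ^ 2 / 4 := hs₁ ▸ hinter₁ γ₁ hγ₁ δ₁ hδ₁ he₁
  have hs₂R : (s₂ : ℝ) = k - (κ⁻¹ ^ 2 - 1) / 4 := hs₂ ▸ hinter₂ γ₂ hγ₂ δ₂ hδ₂ he₂
  obtain ⟨B, hB⟩ : ∃ B, B = (Ω \ Γ).image (negSet Γ w) := ⟨_, rfl⟩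
  have hBcard : B.card = (Ω \ Γ).card := by
    rw [hB, Finset.card_image_of_injOn h.injOn_negSet]
  have hBmem : ∀ b ∈ B, ∃ γ ∈ Ω \ Γ, negSet Γ w γ = b := fun b hb =>
    Finset.mem_image.1 (hB ▸ hb)
  have hBof : ∀ γ ∈ Ω \ Γ, negSet Γ w γ ∈ B := fun γ hγ =>
    hB ▸ Finset.mem_image_of_mem _ hγ
  have hBsub : ∀ b ∈ B, b ⊆ Γ := fun b hb => by
    obtain ⟨γ, -, rfl⟩ := hBmem b hb
    exact negSet_subset Γ w γ
  have hBk : ∀ b ∈ B, b.card = k := fun b hb => by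
    obtain ⟨γ, hγ, rfl⟩ := hBmem b hb
    exact hk γ hγ
  have hBinter : ∀ b ∈ B, ∀ c ∈ B, b ≠ c → (b ∩ c).card = s₁ ∨ (b ∩ c).card = s₂ := by
    intro b hb c hc hbc
    obtain ⟨γ, hγ, rfl⟩ := hBmem b hb
    obtain ⟨δ, hδ, rfl⟩ := hBmem c hc
    have hne : γ ≠ δ := by
      rintro rfl
      exact hbc rfl
    have h1 := h.abs_inner γ (Finset.mem_sdiff.1 hγ).1 δ (Finset.mem_sdiff.1 hδ).1 hne
    rcases (abs_eq hκ.le).1 h1 with h2 | h2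
    · left
      exact Nat.cast_injective (R := ℝ) (by rw [hinter₁ γ hγ δ hδ h2, hs₁R])
    · right
      exact Nat.cast_injective (R := ℝ) (by rw [hinter₂ γ hγ δ hδ h2, hs₂R])
  obtain ⟨i₀, hi₀⟩ : Γ.Nonempty := Finset.card_pos.1 (by omega)
  obtain ⟨r, hr⟩ : ∃ r, r = (B.filter fun b => i₀ ∈ b).card := ⟨_, rfl⟩
  have hBr : ∀ i ∈ Γ, (B.filter fun b => i ∈ b).card = r := by
    intro i hi
    rw [hr, hB, h.card_filter_image (i ∈ ·), h.card_filter_image (i₀ ∈ ·),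
      h.card_filter_mem hk (by omega) hi hi₀]
  have hdr : (Γ.card : ℝ) * r = (Ω \ Γ).card * k := by
    have h1 := sum_card_filter_subset hBsub 1
    rw [Finset.sum_congr (s₁ := B) (g := fun _ => (k : ℝ)) rfl fun b hb => by
        rw [Nat.choose_one_right, hBk b hb],
      Finset.sum_congr (g := fun _ => (r : ℝ)) rfl, Finset.sum_const, Finset.sum_const,
      Finset.card_powersetCard, Nat.choose_one_right, nsmul_eq_mul, nsmul_eq_mul, hBcard] at h1
    · exact h1
    · intro T hT
      obtain ⟨hTΓ, hT1⟩ := Finset.mem_powersetCard.1 hT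
      obtain ⟨i, rfl⟩ := Finset.card_eq_one.1 hT1
      simp only [Finset.singleton_subset_iff] at hTΓ ⊢
      rw [hBr i hTΓ]
  obtain ⟨lam, hlam⟩ := h.exists_card_filter_mem_and hk (by omega)
  have hBlam : ∀ T : Finset ι, T ⊆ Γ → T.card = 2 → (B.filter fun b => T ⊆ b).card = lam := by
    intro T hT hT2
    obtain ⟨i, j, hij, rfl⟩ := Finset.card_eq_two.1 hT2
    simp only [Finset.insert_subset_iff, Finset.singleton_subset_iff] at hT ⊢
    rw [hB, h.card_filter_image (fun b => i ∈ b ∧ j ∈ b), hlam i hT.1 j hT.2 hij]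
  -- Counting pairs inside blocks gives `lam d (d - 1) = b k (k - 1)`, and `b (κ⁻¹² - d) = d (d -
  -- 1)` eliminates `b`.
  have hlamR : (lam : ℝ) * (κ⁻¹ ^ 2 - Γ.card) = k * (k - 1) := by
    have h1 := sum_card_filter_subset hBsub 2
    rw [Finset.sum_congr (s₁ := B) (g := fun _ => (k.choose 2 : ℝ)) rfl fun b hb => by rw [hBk b hb],
      Finset.sum_congr (g := fun _ => (lam : ℝ)) rfl, Finset.sum_const, Finset.sum_const,
      Finset.card_powersetCard, nsmul_eq_mul, nsmul_eq_mul, hBcard] at h1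
    · have h2 := two_mul_choose_two Γ.card
      have h3 := two_mul_choose_two k
      have h4 : (0 : ℝ) < Γ.card * (Γ.card - 1) := mul_pos (by linarith) (by linarith)
      refine mul_left_cancel₀ h4.ne' ?_
      linear_combination 2 * (κ⁻¹ ^ 2 - Γ.card) * h1 - lam * (κ⁻¹ ^ 2 - Γ.card) * h2 +
        (Ω \ Γ).card * (κ⁻¹ ^ 2 - Γ.card) * h3 + k * (k - 1) * hbD
    · intro T hT
      obtain ⟨hTΓ, hT2⟩ := Finset.mem_powersetCard.1 hT
      rw [hBlam T hTΓ hT2]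
  refine ⟨?_, k, lam, s₁, s₂, ?_, hQ, hD, ?_, hs₁R, hs₂R, ?_⟩
  · have := Finset.card_sdiff_of_subset h.subset
    omega
  · rw [← hB]
    refine ⟨⟨rfl, hBsub, hBk, hBlam⟩, ?_, hBinter,
      ⟨_, hBof γ₁ hγ₁, _, hBof δ₁ hδ₁, fun he => hne₁ (h.injOn_negSet hγ₁ hδ₁ he), hs₁.symm⟩,
      ⟨_, hBof γ₂ hγ₂, _, hBof δ₂ hδ₂, fun he => hne₂ (h.injOn_negSet hγ₂ hδ₂ he), hs₂.symm⟩⟩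
    intro hs
    rw [hs, hs₂R] at hs₁R
    have : κ⁻¹ - 1 = 0 := by linear_combination -2 * hs₁R
    linarith
  · rw [eq_div_iff hD, hlamR]
  · rw [← hB, exists_isDesign_three_iff (r := r) (s₁ := s₁) (s₂ := s₂) hd3 hBsub hBk
      (fun i hi => by rw [hBr i hi])
      (fun b hb c hc hbc => by exact_mod_cast hBinter b hb c hc hbc), hBcard,
      three_design_equation_iff (by linarith) hρ hb0 hD hbD hdr hQ hs₁R hs₂R]
    -- Since `b = n - d`, the condition `n = d (d + 1) / 2` means `b = d (d - 1) / 2`, that is,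
    -- `κ⁻¹² - d = 2`.
    have h4 : (0 : ℝ) < Γ.card * (Γ.card - 1) := mul_pos (by linarith) (by linarith)
    constructor
    · intro h1
      have h2 : (Γ.card * (Γ.card - 1) : ℝ) * (κ⁻¹ ^ 2 - Γ.card) =
          Γ.card * (Γ.card - 1) * 2 := by
        linear_combination 2 * hbD - 2 * (κ⁻¹ ^ 2 - Γ.card) * (hn + h1)
      linarith [mul_left_cancel₀ h4.ne' h2]
    · intro h1
      rw [h1] at hbD
      linarith

end IsTightSystem

end

/-! ### Proof of the theorem -/

section

open scoped Classical

open scoped RealInnerProductSpace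

variable {d : ℕ}

theorem exists_of_not_isIncoherent {Ω S : Finset (Line d)}
    (hS : ¬ IsIncoherent (coherentTriples Ω) S) :
    ∃ α ∈ S, ∃ β ∈ S, ∃ γ ∈ S, α ≠ β ∧ β ≠ γ ∧ γ ≠ α ∧
      lineInner α β * lineInner β γ * lineInner γ α < 0 := by
  unfold IsIncoherent at hS
  push Not at hS
  obtain ⟨T, hTS, hT3, hT⟩ := hS
  obtain ⟨-, α, β, γ, rfl, hneg⟩ := Finset.mem_filter.1 hT
  refine ⟨α, hTS (by simp), β, hTS (by simp), γ, hTS (by simp), ?_, ?_, ?_, hneg⟩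
  · rintro rfl
    have := Finset.card_le_two (a := α) (b := γ)
    rw [Finset.insert_eq_of_mem (by simp)] at hT3
    omega
  · rintro rfl
    have := Finset.card_le_two (a := α) (b := β)
    rw [Finset.pair_eq_singleton] at hT3
    omega
  · rintro rfl
    have := Finset.card_le_two (a := β) (b := γ)
    rw [Finset.insert_eq_of_mem (by simp)] at hT3
    omega

theorem card_le_incNumber {Ω S : Finset (Line d)} (hS : S ⊆ Ω)
    (h : IsIncoherent (coherentTriples Ω) S) : S.card ≤ incNumber Ω :=
  Finset.le_sup (f := Finset.card) (Finset.mem_filter.2 ⟨Finset.mem_powerset.2 hS, h⟩)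

theorem isIcosahedral_or_isQuasiSymmetric (Ω : Finset (Line d)) (κ ρ : ℝ)
    (hΩ : IsEquiangular Ω κ) (hρ : ρ = κ⁻¹)
    (hreg : IsRegularTwoGraph Ω (coherentTriples Ω))
    (hInc : incNumber Ω = d)
    (Γ : Finset (Line d)) (hΓΩ : Γ ⊆ Ω)
    (hΓ : IsIncoherent (coherentTriples Ω) Γ) (hΓcard : Γ.card = d)
    (hsmall : ∃ γ ∈ Ω, γ ∉ Γ ∧
      ((gammaOne (coherentTriples Ω) Γ γ).card : ℝ) < (d : ℝ) / 2) :
    (d = 3 ∧ IsIcosahedral Ω) ∨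
    (2 * d < Ω.card ∧
      ∃ k lam s₁ s₂ : ℕ,
        IsQuasiSymmetric 2 d k lam s₁ s₂ Γ
          (blocksOne (coherentTriples Ω) Ω Γ) ∧
        4 * (k : ℝ) ^ 2 - 4 * (d : ℝ) * (k : ℝ) + (ρ - 1) ^ 2 * ((d : ℝ) + ρ) = 0 ∧
        ρ ^ 2 - (d : ℝ) ≠ 0 ∧
        (lam : ℝ) = (k : ℝ) * ((k : ℝ) - 1) / (ρ ^ 2 - (d : ℝ)) ∧
        (s₁ : ℝ) = (k : ℝ) - (ρ - 1) ^ 2 / 4 ∧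
        (s₂ : ℝ) = (k : ℝ) - (ρ ^ 2 - 1) / 4 ∧
        ((Ω.card : ℝ) = (d : ℝ) * ((d : ℝ) + 1) / 2 ↔
          ∃ lam₃ : ℕ, IsDesign 3 d k lam₃ Γ
            (blocksOne (coherentTriples Ω) Ω Γ))) := by
  subst hρ
  obtain ⟨γ₀, hγ₀Ω, hγ₀Γ, hsm⟩ := hsmall
  obtain ⟨-, a, hdes⟩ := hreg
  have hγ₀ : γ₀ ∈ Ω \ Γ := Finset.mem_sdiff.2 ⟨hγ₀Ω, hγ₀Γ⟩
  have hninc : ∀ γ ∈ Ω \ Γ, ¬ IsIncoherent (coherentTriples Ω) (insert γ Γ) := by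
    intro γ hγ hinc
    obtain ⟨hγΩ, hγΓ⟩ := Finset.mem_sdiff.1 hγ
    have h1 := card_le_incNumber (Finset.insert_subset hγΩ hΓΩ) hinc
    rw [Finset.card_insert_of_notMem hγΓ] at h1
    omega
  -- The range of `κ` is not assumed: adding `γ₀` to `Γ` creates a coherent triple, whose product is
  -- nonzero, and distinct lines have cosine below `1`.
  obtain ⟨hκ0, hκ1⟩ : 0 < κ ∧ κ < 1 := by
    obtain ⟨α, hα, β, hβ, γ, hγ, hαβ, -, -, hneg⟩ := exists_of_not_isIncoherent (hninc γ₀ hγ₀)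
    have hsub := Finset.insert_subset hγ₀Ω hΓΩ
    rw [← hΩ α (hsub hα) β (hsub hβ) hαβ]
    refine ⟨abs_pos.2 fun h0 => ?_, abs_lineInner_lt_one hαβ⟩
    rw [h0, zero_mul, zero_mul] at hneg
    exact lt_irrefl _ hneg
  have hlt : Γ.card < Ω.card :=
    Finset.card_lt_card ⟨hΓΩ, fun hs => hγ₀Γ (hs hγ₀Ω)⟩
  obtain ⟨w, hw, hwΓ, hwN⟩ := exists_unitChoice hΩ hΓΩ hΓ hκ0
  have h : IsTightSystem Ω Γ w κ := isTightSystem_of_regular hΩ hdes hΓΩ hlt hw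
    ⟨hκ0, hκ1, fun i _ => hw.inner_self i, hwΓ, by simp [hΓcard]⟩
  have hN : ∀ γ ∈ Ω \ Γ, 2 * (negSet Γ w γ).card ≤ Γ.card := fun γ hγ =>
    hwN γ (Finset.mem_sdiff.1 hγ).1 (Finset.mem_sdiff.1 hγ).2
  have hsplit : ∀ γ ∈ Ω \ Γ, gammaOne (coherentTriples Ω) Γ γ = negSet Γ w γ ∨
      2 * (negSet Γ w γ).card = Γ.card ∧
        2 * (gammaOne (coherentTriples Ω) Γ γ).card = Γ.card := by
    intro γ hγ
    obtain ⟨S₂, hS⟩ := gammaOne_spec hΓ (hninc γ hγ)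
    exact (hS.eq_negSet hw h hγ (hN γ hγ)).2
  obtain ⟨k, hk⟩ : ∃ k, ∀ γ ∈ Ω \ Γ, (negSet Γ w γ).card = k :=
    ⟨_, fun γ hγ => h.card_negSet_eq hγ hγ₀ (hN γ hγ) (hN γ₀ hγ₀)⟩
  have hsm' : 2 * (gammaOne (coherentTriples Ω) Γ γ₀).card < d := by
    have h1 : (2 : ℝ) * (gammaOne (coherentTriples Ω) Γ γ₀).card < d := by linarith
    exact_mod_cast h1
  -- The line `γ₀` excludes two equal halves, and as the block size is common to all lines it
  -- excludes them everywhere.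
  have hkd : 2 * k < d := by
    rcases hsplit γ₀ hγ₀ with h1 | h1
    · rwa [h1, hk γ₀ hγ₀] at hsm'
    · omega
  have hblocks : blocksOne (coherentTriples Ω) Ω Γ = (Ω \ Γ).image (negSet Γ w) := by
    have h1 : ∀ γ ∈ Ω \ Γ, gammaOne (coherentTriples Ω) Γ γ = negSet Γ w γ := by
      intro γ hγ
      rcases hsplit γ hγ with h2 | h2
      · exact h2
      · have := hk γ hγ
        omega
    ext b
    simp only [blocksOne, Finset.mem_image]
    exact ⟨fun ⟨γ, hγ, hb⟩ => ⟨γ, hγ, (h1 γ hγ) ▸ hb⟩,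
      fun ⟨γ, hγ, hb⟩ => ⟨γ, hγ, (h1 γ hγ).trans hb⟩⟩
  have hk0 : 0 < k := hk γ₀ hγ₀ ▸ h.negSet_nonempty hγ₀
  by_cases hle : (Ω \ Γ).card ≤ d
  · left
    have hbD := h.card_sdiff_mul ⟨γ₀, hγ₀⟩
    have hQ := h.quadratic hγ₀
    rw [hk γ₀ hγ₀, hΓcard] at hQ
    rw [hΓcard] at hbD
    obtain ⟨hd3, hk1, h5⟩ := icosahedral_parameters (by omega) hkd h.one_lt_inv
      (Nat.cast_pos.2 (Finset.card_pos.2 ⟨γ₀, hγ₀⟩)) (Nat.cast_le.2 hle) hbD hQ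
    refine ⟨hd3, ?_⟩
    subst hd3
    subst hk1
    have hb3 : (Ω \ Γ).card = 3 := by
      rw [h5, Real.sq_sqrt (by norm_num)] at hbD
      have h6 : ((Ω \ Γ).card : ℝ) = 3 := by
        push_cast at hbD
        linarith
      exact_mod_cast h6
    exact isIcosahedral_of_parameters hw h (by rw [← h5, inv_inv]) hΓcard hb3 hk
  · right
    rw [not_le] at hle
    rw [hblocks]
    refine h.exists_isQuasiSymmetric hΓcard hk hkd hle ?_
    -- More than `d` lines lie outside `Γ`, so they contain a coherent triple, which needs a
    -- negative inner product.
    have hni : ¬ IsIncoherent (coherentTriples Ω) (Ω \ Γ) := fun hinc => by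
      have := card_le_incNumber Finset.sdiff_subset hinc
      omega
    obtain ⟨α, hα, β, hβ, γ, hγ, hαβ, hβγ, hγα, hneg⟩ := exists_of_not_isIncoherent hni
    rw [← hw.triple] at hneg
    by_contra! hcon
    have hpos : ∀ x ∈ Ω \ Γ, ∀ y ∈ Ω \ Γ, x ≠ y → ⟪w x, w y⟫ = κ := by
      intro x hx y hy hxy
      have h1 := h.abs_inner x (Finset.mem_sdiff.1 hx).1 y (Finset.mem_sdiff.1 hy).1 hxy
      exact ((abs_eq hκ0.le).1 h1).resolve_right (hcon x hx y hy hxy)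
    rw [hpos α hα β hβ hαβ, hpos β hβ γ hγ hβγ, hpos γ hγ α hα hγα] at hneg
    have := pow_pos hκ0 3
    linarith

end

end EquiLines

theorem mainTheorem6 (d : ℕ) (Ω : Finset (EquiLines.Line d)) (κ ρ : ℝ)
    (hΩ : EquiLines.IsEquiangular Ω κ) (hρ : ρ = κ⁻¹)
    (hreg : EquiLines.IsRegularTwoGraph Ω (EquiLines.coherentTriples Ω))
    (hInc : EquiLines.incNumber Ω = d)
    (Γ : Finset (EquiLines.Line d)) (hΓΩ : Γ ⊆ Ω)
    (hΓ : EquiLines.IsIncoherent (EquiLines.coherentTriples Ω) Γ) (hΓcard : Γ.card = d)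
    (hsmall : ∃ γ ∈ Ω, γ ∉ Γ ∧
      ((EquiLines.gammaOne (EquiLines.coherentTriples Ω) Γ γ).card : ℝ) < (d : ℝ) / 2) :
    (d = 3 ∧ EquiLines.IsIcosahedral Ω) ∨
    (2 * d < Ω.card ∧
      ∃ k lam s₁ s₂ : ℕ,
        EquiLines.IsQuasiSymmetric 2 d k lam s₁ s₂ Γ
          (EquiLines.blocksOne (EquiLines.coherentTriples Ω) Ω Γ) ∧
        4 * (k : ℝ) ^ 2 - 4 * (d : ℝ) * (k : ℝ) + (ρ - 1) ^ 2 * ((d : ℝ) + ρ) = 0 ∧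
        ρ ^ 2 - (d : ℝ) ≠ 0 ∧
        (lam : ℝ) = (k : ℝ) * ((k : ℝ) - 1) / (ρ ^ 2 - (d : ℝ)) ∧
        (s₁ : ℝ) = (k : ℝ) - (ρ - 1) ^ 2 / 4 ∧
        (s₂ : ℝ) = (k : ℝ) - (ρ ^ 2 - 1) / 4 ∧
        ((Ω.card : ℝ) = (d : ℝ) * ((d : ℝ) + 1) / 2 ↔
          ∃ lam₃ : ℕ, EquiLines.IsDesign 3 d k lam₃ Γ
            (EquiLines.blocksOne (EquiLines.coherentTriples Ω) Ω Γ))) :=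
  EquiLines.isIcosahedral_or_isQuasiSymmetric Ω κ ρ hΩ hρ hreg hInc Γ hΓΩ hΓ hΓcard hsmall
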